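/- Let $(\Omega,\mathcal F,\mathbb P)$ be a complete probability space, $\mathcal H\subseteq\mathcal F$ a sub-$\sigma$-algebra, and $\mathbb X$ a separable real Banach space. Its dual $\mathbb X^*$ carries the weak-star topology $\sigma(\mathbb X^*,\mathbb X)$ and the corresponding Borel $\sigma$-algebra. For a $\sigma$-algebra $\mathcal G$ on $\Omega$, a $\mathcal G$-measurable random set in $V\in\{\mathbb X,\mathbb X^*\}$ is a map $X$ from $\Omega$ to the subsets of $V$ whose graph $\{(\omega,x): x\in X(\omega)\}$ belongs to $\mathcal G\otimes\mathcal B(V)$; it is called closed (convex, a cone) if $X(\omega)$ is so for almost all $\omega$. Cones contain the origin. For a map $X$ from $\Omega$ to the subsets of $V$: - the conditional core $m(X|\mathcal H)$ is the largest $\mathcal H$-measurable random set $X'$ with $X'\subseteq X$ a.s. (it contains a.s. every other such set); - the conditional convex hull $M(X|\mathcal H)$ is the smallest $\mathcal H$-measurable random closed convex set $X'$ with $X\subseteq X'$ a.s. (it is a.s. contained in every other such set); - if $V=\mathbb X$ and $X$ is a random closed set with at least one Bochner integrable $\mathcal F$-measurable selection, the conditional expectation $\mathbb E(X|\mathcal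 H)$ is the $\mathcal H$-measurable random closed set in $\mathbb X$ whose set of integrable $\mathcal H$-measurable selections is the $L^1$-closure of $\{\mathbb E(\xi|\mathcal H):\xi \text{ an integrable } \mathcal F\text{-measurable selection of } X\}$. The positive dual cone of $C\subseteq\mathbb X$ is $C^*=\{u\in\mathbb X^*:\langle u,x\rangle\ge0\ \forall x\in C\}$, and that of $D\subseteq\mathbb X^*$ is $D^*=\{x\in\mathbb X:\langle u,x\rangle\ge0\ \forall u\in D\}$. **Proposition 7.1.** Let $K$ be an $\mathcal F$-measurable random closed convex cone in $\mathbb X$. Then $m(K|\mathcal H)$, $M(K|\mathcal H)$, $M(K^*|\mathcal H)$ and $\mathbb E(K|\mathcal H)$ exist, and, whichever versions of them are taken, $m(K|\mathcal H)$ and $M(K|\mathcal H)$ are a.s. closed convex cones, $$m(K|\mathcal H)=M(K^*|\mathcal H)^*\quad\text{a.s.},\qquad \mathbb E(K|\mathcal H)=M(K|\mathcal H)\quad\text{a.s.}$$ -/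

import Mathlib

open MeasureTheory TopologicalSpace

/-- A set-valued map `X` on `Ω` is an `H`-measurable random set if its graph belongs to the product
of `H` with the Borel `σ`-algebra of `V`. -/
def IsRandomSet {Ω V : Type*} [TopologicalSpace V] (H : MeasurableSpace Ω) (X : Ω → Set V) : Prop :=
  MeasurableSet[H.prod (borel V)] {p : Ω × V | p.2 ∈ X p.1}

/-- `C` is a closed convex cone (containing the origin). -/
def IsClosedConvexCone {V : Type*} [AddCommGroup V] [Module ℝ V] [TopologicalSpace V]
    (C : Set V) : Prop :=
  ∃ P : ProperCone ℝ V, (P : Set V) = C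

/-- The positive dual cone in the dual space, which carries the weak-star topology. -/
def posDual {E : Type*} [NormedAddCommGroup E] [NormedSpace ℝ E] (C : Set E) :
    Set (WeakDual ℝ E) :=
  {u | ∀ x ∈ C, 0 ≤ u x}

/-- The positive dual cone, with respect to the same pairing, of a subset of the dual space. -/
def posPredual {E : Type*} [NormedAddCommGroup E] [NormedSpace ℝ E] (D : Set (WeakDual ℝ E)) :
    Set E :=
  {x | ∀ u ∈ D, 0 ≤ u x}

/-- `m` is (a version of) the conditional core of `X` given `H`: the largest `H`-measurable random
set that is almost surely contained in `X`. -/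
structure IsCondCore {Ω V : Type*} [TopologicalSpace V] (H : MeasurableSpace Ω)
    {mΩ : MeasurableSpace Ω} (μ : Measure Ω) (X m : Ω → Set V) : Prop where
  measurable : IsRandomSet H m
  subset : ∀ᵐ ω ∂μ, m ω ⊆ X ω
  largest : ∀ Z : Ω → Set V, IsRandomSet H Z → (∀ᵐ ω ∂μ, Z ω ⊆ X ω) → ∀ᵐ ω ∂μ, Z ω ⊆ m ω

/-- `M` is (a version of) the conditional convex hull of `X` given `H`: the smallest `H`-measurable
random convex closed set that almost surely contains `X`. -/
structure IsCondHull {Ω V : Type*} [AddCommGroup V] [Module ℝ V] [TopologicalSpace V]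
    (H : MeasurableSpace Ω) {mΩ : MeasurableSpace Ω} (μ : Measure Ω) (X M : Ω → Set V) :
    Prop where
  measurable : IsRandomSet H M
  closed : ∀ᵐ ω ∂μ, IsClosed (M ω)
  convex : ∀ᵐ ω ∂μ, Convex ℝ (M ω)
  subset : ∀ᵐ ω ∂μ, X ω ⊆ M ω
  smallest : ∀ Z : Ω → Set V, IsRandomSet H Z → (∀ᵐ ω ∂μ, IsClosed (Z ω)) →
    (∀ᵐ ω ∂μ, Convex ℝ (Z ω)) → (∀ᵐ ω ∂μ, X ω ⊆ Z ω) → ∀ᵐ ω ∂μ, M ω ⊆ Z ω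

/-- The integrable `H`-measurable selections of `X`, as a set of classes in `L¹`. -/
def integrableSelections {Ω E : Type*} [NormedAddCommGroup E]
    (H : MeasurableSpace Ω) {mΩ : MeasurableSpace Ω} (μ : Measure Ω) (X : Ω → Set E) :
    Set (Lp E 1 μ) :=
  {f | AEStronglyMeasurable[H] f μ ∧ ∀ᵐ ω ∂μ, f ω ∈ X ω}

/-- `Y` is (a version of) the conditional (selection) expectation given `H` of the integrable random
set `X`: the `H`-measurable random closed set whose family of integrable `H`-measurable selections is
the `L¹`-closure of the conditional expectations of all integrable selections of `X`. -/
structure IsCondExpSet {Ω E : Type*} [NormedAddCommGroup E] [NormedSpace ℝ E] [CompleteSpace E]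
    (H : MeasurableSpace Ω) {mΩ : MeasurableSpace Ω} (μ : Measure Ω) (X Y : Ω → Set E) :
    Prop where
  integrable : (integrableSelections mΩ μ X).Nonempty
  measurable : IsRandomSet H Y
  closed : ∀ᵐ ω ∂μ, IsClosed (Y ω)
  selections_eq : integrableSelections H μ Y =
    closure {g : Lp E 1 μ | ∃ ξ ∈ integrableSelections mΩ μ X, g =ᵐ[μ] μ[ξ|H]}

/-! Random sets are handled through countably many measurable selections, dense in almost every
value (`IsRandomSet.exists_castaing`). These come from Aumann's theorem, which rests on the
universal measurability of analytic sets.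

Core: encode `K` by a dense sequence of selections and take the conditional law of this sequence
given `H`. The points lying in the closure of almost every sequence under that law form the core:
conditioning freezes an `H`-measurable map, so it selects `K` exactly when it selects this set.
Maximality then forces any version to be a closed cone.

Duality: let `m` be the core, and let `Z` be `H`-measurable, closed, convex and contain the dual of
`K`. The largest cone inside `Z` still contains that dual, so by the bipolar theorem its predual
lies in `K`, hence in `m`. Dualizing again, the dual of `m` lies in `Z`. So the dual of `m` is the
hull of the dual of `K`, and the bipolar theorem recovers `m`.

Hull and expectation: let `M` be the closed cone generated by conditional expectations of suitable
bounded selections of `K`. An `H`-measurable closed convex set containing `K` contains these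
expectations (`IsRandomSet.condExp_mem`), so `M` is the hull once it contains `K`. Here the cone
property is decisive: if a selection stays in a small ball on an event `A`, its conditional
expectation restricted to `A`, divided by the conditional probability of `A`, lies in that ball too.
Gluing the generators along events of `H` approximates every integrable selection of `M` in `L¹`, so
`M` is also the conditional expectation. -/

/-! ### Analytic sets and measurable selection -/

/-- The set of sequences of natural numbers dominated by a given sequence is compact. -/
theorem isCompact_setOf_forall_le (b : ℕ → ℕ) : IsCompact {σ : ℕ → ℕ | ∀ i, σ i ≤ b i} := by
  convert isCompact_univ_pi (s := fun i => Set.Iic (b i)) fun i => (Set.finite_Iic (b i)).isCompact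
    using 1
  ext σ
  simp [Pi.le_def]

open Set Filter Topology in
/-- An open set containing the compact set of sequences dominated by `b` contains all the sequences
of which a long enough initial segment is dominated by `b`. -/
theorem exists_forall_le_subset_of_isOpen (b : ℕ → ℕ) {W : Set (ℕ → ℕ)} (hW : IsOpen W)
    (hb : {σ : ℕ → ℕ | ∀ i, σ i ≤ b i} ⊆ W) :
    ∃ n, {σ : ℕ → ℕ | ∀ i < n, σ i ≤ b i} ⊆ W := by
  let : MetricSpace (ℕ → ℕ) := PiNat.metricSpaceNatNat
  have hK := isCompact_setOf_forall_le b
  obtain ⟨δ, hδ, h⟩ := hK.exists_thickening_subset_open hW hb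
  obtain ⟨n, hn⟩ := exists_pow_lt_of_lt_one hδ (by norm_num : (1 / 2 : ℝ) < 1)
  refine ⟨n, fun σ hσ => h ?_⟩
  rw [Metric.mem_thickening_iff]
  -- The truncation of `σ` is dominated by `b` and agrees with `σ` on the first `n` coordinates,
  -- hence is within `(1 / 2) ^ n` of it.
  refine ⟨fun i => if i < n then σ i else 0, fun i => ?_, lt_of_le_of_lt ?_ hn⟩
  · by_cases hi : i < n <;> simp [hi, hσ i]
  · rw [← PiNat.mem_cylinder_iff_dist_le]
    intro i hi
    simp [hi]

open Set Filter Topology in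
/-- The continuous image of the Baire space has compact subsets of almost full measure. -/
theorem exists_isCompact_subset_range_measure {C : Type*} [TopologicalSpace C] [PolishSpace C]
    [MeasurableSpace C] [BorelSpace C] (ν : Measure C) [IsFiniteMeasure ν] {g : (ℕ → ℕ) → C}
    (hg : Continuous g) {ε : ENNReal} (hε : ε ≠ 0) :
    ∃ K ⊆ range g, IsCompact K ∧ ν (range g) ≤ ν K + ε := by
  let := upgradeIsCompletelyMetrizable C
  obtain ⟨δ, hδ, hδε⟩ := ENNReal.exists_pos_sum_of_countable' hε ℕ
  -- Bounding the `n`-th coordinate costs at most `δ n`, by continuity from below of the outer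
  -- measure; the images need not be measurable.
  have step : ∀ (T : Set (ℕ → ℕ)) (n : ℕ), ∃ k, ν (g '' T) ≤ ν (g '' (T ∩ {σ | σ n ≤ k})) + δ n := by
    intro T n
    have hU : g '' T = ⋃ k, g '' (T ∩ {σ | σ n ≤ k}) := by
      rw [← image_iUnion, ← inter_iUnion]
      congr 1
      rw [eq_comm, inter_eq_left]
      intro σ _
      exact mem_iUnion.2 ⟨σ n, le_refl (σ n)⟩
    have hmono : Monotone fun k => g '' (T ∩ {σ | σ n ≤ k}) := fun k l hkl =>
      image_mono (inter_subset_inter_right _ fun σ (hσ : σ n ≤ k) => hσ.trans hkl)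
    have ht := tendsto_measure_iUnion_atTop (μ := ν) hmono
    rw [← hU] at ht
    by_contra! hcon
    have h2 : Tendsto (fun k => ν (g '' (T ∩ {σ | σ n ≤ k})) + δ n) atTop (𝓝 (ν (g '' T) + δ n)) :=
      ht.add tendsto_const_nhds
    have h3 := le_of_tendsto' h2 fun k => (hcon k).le
    exact (ENNReal.lt_add_right (measure_ne_top ν _) (hδ n).ne').not_ge h3
  choose k hk using step
  let T : ℕ → Set (ℕ → ℕ) := fun n => Nat.rec univ (fun n T => T ∩ {σ | σ n ≤ k T n}) n
  let b : ℕ → ℕ := fun n => k (T n) n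
  have hT : ∀ n, T n = {σ | ∀ i < n, σ i ≤ b i} := by
    intro n
    induction n with
    | zero => ext σ; simp [T]
    | succ n ih =>
      have : T (n + 1) = T n ∩ {σ | σ n ≤ b n} := rfl
      rw [this, ih]
      ext σ
      simp only [mem_inter_iff, mem_ofPred_eq, Nat.lt_succ_iff_lt_or_eq, or_imp, forall_and,
        forall_eq]
  have hsum : ∀ n, ν (range g) ≤ ν (g '' T n) + ∑ i ∈ Finset.range n, δ i := by
    intro n
    induction n with
    | zero => simp [T]
    | succ n ih =>
      rw [Finset.sum_range_succ, add_comm _ (δ n), ← add_assoc]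
      exact ih.trans (by gcongr; exact hk (T n) n)
  have hK := isCompact_setOf_forall_le b
  refine ⟨g '' {σ | ∀ i, σ i ≤ b i}, image_subset_range _ _, hK.image hg, ?_⟩
  -- Outer regularity: every open set around the compact image already contains the image of some `T
  -- n`, which has lost at most the sum of the `δ i`.
  rw [Set.measure_eq_iInf_isOpen (g '' {σ | ∀ i, σ i ≤ b i}) ν, ENNReal.iInf_add]
  refine le_iInf fun V => ?_
  rw [ENNReal.iInf_add]
  refine le_iInf fun hV => ?_
  rw [ENNReal.iInf_add]
  refine le_iInf fun hVo => ?_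
  obtain ⟨n, hn⟩ := exists_forall_le_subset_of_isOpen b (hVo.preimage hg) (image_subset_iff.1 hV)
  rw [← hT] at hn
  exact (hsum n).trans (add_le_add (measure_mono (image_subset_iff.2 hn))
    ((ENNReal.sum_le_tsum _).trans hδε.le))

open Set Filter Topology in
/-- Analytic sets are universally measurable. -/
theorem MeasureTheory.AnalyticSet.nullMeasurableSet {C : Type*} [TopologicalSpace C] [PolishSpace C]
    [MeasurableSpace C] [BorelSpace C] {s : Set C} (hs : AnalyticSet s) (ν : Measure C)
    [IsFiniteMeasure ν] : NullMeasurableSet s ν := by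
  rw [AnalyticSet] at hs
  rcases hs with rfl | ⟨g, hg, rfl⟩
  · simp
  choose K hKs hKc hKν using fun n : ℕ =>
    exists_isCompact_subset_range_measure ν hg (ε := ((n : ENNReal) + 1)⁻¹) (by simp)
  have hsub : (⋃ n, K n) ⊆ range g := iUnion_subset hKs
  have hmeas : MeasurableSet (⋃ n, K n) := .iUnion fun n => (hKc n).measurableSet
  have hle : ν (range g) ≤ ν (⋃ n, K n) := by
    have h1 : Tendsto (fun n : ℕ => ν (⋃ n, K n) + ((n : ENNReal) + 1)⁻¹) atTop
        (𝓝 (ν (⋃ n, K n) + 0)) := by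
      refine tendsto_const_nhds.add ?_
      have := (tendsto_add_atTop_iff_nat 1).2 ENNReal.tendsto_inv_nat_nhds_zero
      simpa using this
    rw [add_zero] at h1
    exact ge_of_tendsto' h1 fun n =>
      (hKν n).trans (by gcongr; exact subset_iUnion K n)
  refine hmeas.nullMeasurableSet.congr ?_
  exact ae_eq_of_subset_of_measure_ge hsub hle hmeas.nullMeasurableSet (measure_ne_top _ _)

open Set Filter Topology in
/-- A continuous map on the Baire space has a Borel section on almost all of its range. -/
theorem exists_measurable_section {C : Type*} [TopologicalSpace C] [PolishSpace C]
    [MeasurableSpace C] [BorelSpace C] (ν : Measure C) [IsFiniteMeasure ν] {h : (ℕ → ℕ) → C}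
    (hh : Continuous h) :
    ∃ (D : Set C) (s : C → ℕ → ℕ), MeasurableSet D ∧ Measurable s ∧ (∀ c ∈ D, h (s c) = c) ∧
      ∀ᵐ c ∂ν, c ∈ range h → c ∈ D := by
  classical
  let : MeasurableSpace (List ℕ) := ⊤
  have : DiscreteMeasurableSpace (List ℕ) := ⟨fun _ => trivial⟩
  -- Images of cylinders. `PiNat.res` lists the digits latest first, so a new digit is put at the
  -- head.
  let A : List ℕ → Set C := fun l => h '' {τ | PiNat.res τ l.length = l}
  have hA : ∀ l, NullMeasurableSet (A l) ν := by
    intro l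
    refine AnalyticSet.nullMeasurableSet ?_ ν
    refine AnalyticSet.image_of_continuous (IsClosed.analyticSet ?_) hh
    rcases Set.eq_empty_or_nonempty {τ : ℕ → ℕ | PiNat.res τ l.length = l} with he | ⟨x, hx⟩
    · rw [he]; exact isClosed_empty
    · have : {τ : ℕ → ℕ | PiNat.res τ l.length = l} = PiNat.cylinder x l.length := by
        rw [PiNat.cylinder_eq_res, show PiNat.res x l.length = l from hx]
      rw [this]
      simp only [PiNat.cylinder, ofPred_forall]
      exact isClosed_biInter fun i _ => isClosed_eq (continuous_apply i) continuous_const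
  choose A' hA'A hA'm hA'e using fun l => (hA l).exists_measurable_superset_ae_eq
  have hgood : ∀ᵐ c ∂ν, ∀ l, c ∈ A' l ↔ c ∈ A l :=
    ae_all_iff.2 fun l => (hA'e l).mem_iff
  obtain ⟨N, hNsub, hNm, hN0⟩ := exists_measurable_superset_of_null hgood
  have hGsub : ∀ c ∈ Nᶜ, ∀ l, c ∈ A' l ↔ c ∈ A l := fun c hc => by
    by_contra h
    exact hc (hNsub h)
  -- The next digit is the least one that keeps `c` in the image of the cylinder; the second
  -- alternative only makes the search total.
  let p : C × List ℕ → ℕ → Prop := fun q k => q.1 ∈ A' (k :: q.2) ∨ ∀ j, q.1 ∉ A' (j :: q.2)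
  have hp : ∀ q, ∃ k, p q k := by
    intro q
    by_cases hq : ∃ k, q.1 ∈ A' (k :: q.2)
    · exact hq.imp fun k hk => Or.inl hk
    · exact ⟨0, Or.inr (not_exists.1 hq)⟩
  have hpm : ∀ k, MeasurableSet {q | p q k} := by
    intro k
    have : Measurable fun q : C × List ℕ => p q k := by
      refine measurable_from_prod_countable_left fun l => ?_
      exact Measurable.or (hA'm (k :: l)).mem (Measurable.forall fun j => (hA'm (j :: l)).mem.not)
    exact this.setOf
  let next : C × List ℕ → ℕ := fun q => Nat.find (hp q)
  have hnext : Measurable next := measurable_find hp hpm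
  let F : ℕ → C → List ℕ := fun n => Nat.rec (fun _ => []) (fun _ f c => next (c, f c) :: f c) n
  have hF : ∀ n, Measurable (F n) := by
    intro n
    induction n with
    | zero => exact measurable_const
    | succ n ih =>
      have : Measurable fun q : ℕ × List ℕ => q.1 :: q.2 := Measurable.of_discrete
      exact this.comp ((hnext.comp (measurable_id.prodMk ih)).prodMk ih)
  let s : C → ℕ → ℕ := fun c n => next (c, F n c)
  have hs : ∀ c n, PiNat.res (s c) n = F n c := by
    intro c n
    induction n with
    | zero => rfl
    | succ n ih => rw [PiNat.res_succ, ih]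
  refine ⟨A' [] ∩ Nᶜ, s, (hA'm _).inter hNm.compl, measurable_pi_lambda _ fun n =>
    hnext.comp (measurable_id.prodMk (hF n)), ?_, ?_⟩
  · rintro c ⟨hc, hcG⟩
    have hcA := hGsub c hcG
    have key : ∀ n, c ∈ A (F n c) := by
      intro n
      induction n with
      | zero => exact (hcA _).1 hc
      | succ n ih =>
        obtain ⟨τ, hτ, hτc⟩ := ih
        have h1 : c ∈ A' (τ (F n c).length :: F n c) := by
          refine (hcA _).2 ⟨τ, ?_, hτc⟩
          rw [mem_ofPred_eq, List.length_cons, PiNat.res_succ, show PiNat.res τ _ = _ from hτ]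
        rcases Nat.find_spec (hp (c, F n c)) with h2 | h2
        · exact (hcA _).1 h2
        · exact absurd h1 (h2 _)
    have hlen : ∀ n, (F n c).length = n := fun n => by rw [← hs, PiNat.res_length]
    choose τ hτ hτc using key
    -- The preimages `τ n` of `c` share longer and longer initial segments with `s c`, so continuity
    -- of `h` gives `h (s c) = c`.
    have hlim : Tendsto τ atTop (𝓝 (s c)) := by
      refine tendsto_pi_nhds.2 fun i => tendsto_const_nhds.congr' ?_
      filter_upwards [eventually_gt_atTop i] with n hn
      have h1 : PiNat.res (τ n) n = PiNat.res (s c) n := by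
        have := hτ n
        rwa [mem_ofPred_eq, hlen, ← hs] at this
      exact (PiNat.res_eq_res.1 h1 hn).symm
    refine tendsto_nhds_unique ((hh.tendsto _).comp hlim) ?_
    simp [Function.comp_def, hτc]
  · filter_upwards [measure_eq_zero_iff_ae_notMem.1 hN0] with c hcG hc
    refine ⟨(hGsub c hcG _).2 ?_, hcG⟩
    obtain ⟨τ, rfl⟩ := hc
    exact ⟨τ, rfl, rfl⟩

/-- Every measurable set of a product with a Polish space is the preimage of a Borel set under a
measurable map of the first factor to the Baire space. -/
theorem exists_measurable_baire_preimage {Ω V : Type*} [MeasurableSpace Ω] [MeasurableSpace V]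
    {A : Set (Ω × V)} (hA : MeasurableSet A) :
    ∃ f : Ω → ℕ → ℕ, Measurable f ∧ ∃ A' : Set ((ℕ → ℕ) × V), MeasurableSet A' ∧
      A = Prod.map f id ⁻¹' A' := by
  classical
  refine MeasurableSpace.induction_on_inter (C := fun A _ => ∃ f : Ω → ℕ → ℕ, Measurable f ∧
    ∃ A' : Set ((ℕ → ℕ) × V), MeasurableSet A' ∧ A = Prod.map f id ⁻¹' A')
    generateFrom_prod.symm isPiSystem_prod ?_ ?_ ?_ ?_ A hA
  · exact ⟨fun _ _ => 0, measurable_const, ∅, .empty, rfl⟩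
  · rintro _ ⟨s, hs, t, ht, rfl⟩
    refine ⟨fun ω _ => if ω ∈ s then 1 else 0, measurable_pi_lambda _ fun _ => ?_,
      {c | c 0 = 1} ×ˢ t, ?_, ?_⟩
    · exact Measurable.ite hs measurable_const measurable_const
    · refine MeasurableSet.prod ?_ ht
      exact measurable_pi_apply (X := fun _ : ℕ => ℕ) 0 (measurableSet_singleton 1)
    · ext ⟨ω, x⟩; simp
  · rintro _ _ ⟨f, hf, A', hA', rfl⟩
    exact ⟨f, hf, A'ᶜ, hA'.compl, rfl⟩
  · intro s _ _ ih
    choose f hf A' hA' h using ih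
    -- Countably many codes are interleaved into one by the pairing function.
    refine ⟨fun ω n => f n.unpair.1 ω n.unpair.2, measurable_pi_lambda _ fun n =>
      (measurable_pi_apply _).comp (hf _),
      ⋃ i, (fun q : (ℕ → ℕ) × V => (fun j => q.1 (Nat.pair i j), q.2)) ⁻¹' A' i, ?_, ?_⟩
    · refine .iUnion fun i => (Measurable.prodMk ?_ measurable_snd) (hA' i)
      exact measurable_pi_lambda _ fun j => (measurable_pi_apply _).comp measurable_fst
    · ext ⟨ω, x⟩
      simp only [Set.mem_iUnion, Set.mem_preimage, h, Prod.map, Nat.unpair_pair, id]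

/-- **Aumann's measurable selection theorem**: a measurable set of the product of a measurable space
with a Polish space contains the graph of a measurable map on almost all of its projection. -/
theorem exists_measurable_selection {Ω V : Type*} {H mΩ : MeasurableSpace Ω} (hH : H ≤ mΩ)
    (μ : Measure Ω) [IsFiniteMeasure μ] [TopologicalSpace V] [PolishSpace V] [MeasurableSpace V]
    [BorelSpace V] [Nonempty V] {A : Set (Ω × V)} (hA : MeasurableSet[H.prod ‹_›] A) :
    ∃ (B : Set Ω) (ξ : Ω → V), MeasurableSet[H] B ∧ Measurable[H] ξ ∧ (∀ ω ∈ B, (ω, ξ ω) ∈ A) ∧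
      ∀ᵐ ω ∂μ, ω ∉ B → ∀ x, (ω, x) ∉ A := by
  obtain ⟨f, hf, A', hA', rfl⟩ := @exists_measurable_baire_preimage Ω V H _ A hA
  have hf' : Measurable[mΩ] f := hf.mono hH le_rfl
  have := hA'.analyticSet
  rw [AnalyticSet] at this
  rcases this with rfl | ⟨g, hg, rfl⟩
  · exact ⟨∅, fun _ => Classical.arbitrary V, @MeasurableSet.empty Ω H,
      @measurable_const V Ω _ H _, by simp, by simp⟩
  obtain ⟨D, s, hD, hs, hDs, hae⟩ :=
    exists_measurable_section (μ.map f) (continuous_fst.comp hg)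
  refine ⟨f ⁻¹' D, fun ω => (g (s (f ω))).2, hf hD,
    (continuous_snd.comp hg).measurable.comp (hs.comp hf), fun ω hω => ?_, ?_⟩
  · refine ⟨s (f ω), Prod.ext ?_ rfl⟩
    exact hDs _ hω
  · filter_upwards [ae_of_ae_map hf'.aemeasurable hae] with ω hω hωD x hx
    obtain ⟨τ, hτ⟩ := hx
    exact hωD (hω ⟨τ, by simp [hτ]⟩)

/-! ### Measurability of basic random sets -/

theorem isRandomSet_iff {Ω V : Type*} [TopologicalSpace V] [mV : MeasurableSpace V] [BorelSpace V]
    {H : MeasurableSpace Ω} {X : Ω → Set V} :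
    IsRandomSet H X ↔ MeasurableSet[H.prod mV] {p : Ω × V | p.2 ∈ X p.1} := by
  rw [IsRandomSet, BorelSpace.measurable_eq (α := V)]

/-- Pulling back a random set along a continuous map of the space of values. -/
theorem IsRandomSet.preimage {Ω V W : Type*} [TopologicalSpace V] [TopologicalSpace W]
    {H : MeasurableSpace Ω} {X : Ω → Set V} (hX : IsRandomSet H X) {f : W → V}
    (hf : Continuous f) : IsRandomSet H fun ω => f ⁻¹' X ω := by
  borelize V W
  rw [isRandomSet_iff] at hX ⊢
  exact (measurable_id.prodMap hf.measurable) hX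

theorem IsRandomSet.iInter {Ω V ι : Type*} [Countable ι] [TopologicalSpace V]
    {H : MeasurableSpace Ω} {X : ι → Ω → Set V} (hX : ∀ i, IsRandomSet H (X i)) :
    IsRandomSet H fun ω => ⋂ i, X i ω := by
  have := MeasurableSet.iInter hX
  rw [IsRandomSet]
  convert this using 1
  ext p
  simp

theorem IsRandomSet.insert_zero {Ω V : Type*} [TopologicalSpace V] [T1Space V] [Zero V]
    {H : MeasurableSpace Ω} {X : Ω → Set V} (hX : IsRandomSet H X) :
    IsRandomSet H fun ω => insert 0 (X ω) := by
  borelize V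
  rw [isRandomSet_iff] at hX ⊢
  have : MeasurableSet[H.prod _] {p : Ω × V | p.2 = 0} :=
    (measurable_snd : Measurable (Prod.snd : Ω × V → V)) (measurableSet_singleton 0)
  exact this.union hX

/-- The closure of the range of countably many random elements is a random set. -/
theorem isRandomSet_closure_range {Ω E ι : Type*} [H : MeasurableSpace Ω] [PseudoEMetricSpace E]
    [SecondCountableTopology E] [MeasurableSpace E] [BorelSpace E] [Countable ι] {c : ι → Ω → E}
    (hc : ∀ i, Measurable (c i)) : IsRandomSet H fun ω => closure (Set.range fun i => c i ω) := by
  rw [isRandomSet_iff]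
  have : {p : Ω × E | p.2 ∈ closure (Set.range fun i => c i p.1)} =
      {p | ⨅ i, edist p.2 (c i p.1) = 0} := by
    ext p
    simp only [Set.mem_ofPred_eq, Metric.mem_closure_iff_infEDist_zero, Metric.infEDist, iInf_range]
  rw [this]
  exact Measurable.iInf (fun i => measurable_snd.edist ((hc i).comp measurable_fst))
    (measurableSet_singleton 0)

/-- The pairing between a separable normed space and its weak dual is jointly measurable. -/
theorem measurable_weakDual_pairing {E : Type*} [NormedAddCommGroup E] [NormedSpace ℝ E]
    [SeparableSpace E] [MeasurableSpace E] [BorelSpace E] [MeasurableSpace (WeakDual ℝ E)]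
    [BorelSpace (WeakDual ℝ E)] : Measurable fun p : E × WeakDual ℝ E => p.2 p.1 := by
  have := UniformSpace.secondCountable_of_separable E
  exact measurable_uncurry_of_continuous_of_measurable (u := fun (x : E) (u : WeakDual ℝ E) => u x)
    (fun u => ContinuousLinearMap.continuous u) fun x => (WeakDual.eval_continuous x).measurable

theorem isRandomSet_posDual_range {Ω E ι : Type*} [H : MeasurableSpace Ω] [NormedAddCommGroup E]
    [NormedSpace ℝ E] [SeparableSpace E] [MeasurableSpace E] [BorelSpace E] [Countable ι]
    {c : ι → Ω → E} (hc : ∀ i, Measurable (c i)) :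
    IsRandomSet H fun ω => posDual (Set.range fun i => c i ω) := by
  borelize (WeakDual ℝ E)
  rw [isRandomSet_iff]
  have : {p : Ω × WeakDual ℝ E | p.2 ∈ posDual (Set.range fun i => c i p.1)} =
      ⋂ i, {p | 0 ≤ p.2 (c i p.1)} := by
    ext p
    simp [posDual]
  rw [this]
  exact .iInter fun i => measurableSet_le measurable_const
    (measurable_weakDual_pairing.comp (((hc i).comp measurable_fst).prodMk measurable_snd))

theorem isRandomSet_posPredual_range {Ω E ι : Type*} [H : MeasurableSpace Ω] [NormedAddCommGroup E]
    [NormedSpace ℝ E] [SeparableSpace E] [Countable ι] [MeasurableSpace (WeakDual ℝ E)]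
    [BorelSpace (WeakDual ℝ E)] {B : ι → Set Ω} (hB : ∀ i, MeasurableSet (B i))
    {u : ι → Ω → WeakDual ℝ E} (hu : ∀ i, Measurable (u i)) :
    IsRandomSet H fun ω => posPredual {v | ∃ i, ω ∈ B i ∧ u i ω = v} := by
  borelize E
  rw [isRandomSet_iff]
  have : {p : Ω × E | p.2 ∈ posPredual {v | ∃ i, p.1 ∈ B i ∧ u i p.1 = v}} =
      ⋂ i, {p | p.1 ∈ (B i)ᶜ} ∪ {p | 0 ≤ u i p.1 p.2} := by
    ext p
    simp only [posPredual, Set.mem_ofPred_eq, Set.mem_iInter, Set.mem_union, Set.mem_compl_iff,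
      ← imp_iff_not_or]
    exact ⟨fun h i hi => h _ ⟨i, hi, rfl⟩, by rintro h _ ⟨i, hi, rfl⟩; exact h i hi⟩
  rw [this]
  exact .iInter fun i => (measurable_fst (hB i).compl).union <| measurableSet_le measurable_const
    (measurable_weakDual_pairing.comp (measurable_snd.prodMk ((hu i).comp measurable_fst)))

/-! ### Castaing representations -/

open Set in
/-- A **Castaing representation** of a random set in a Polish space: countably many partially
defined measurable selections, dense in almost all values. -/
theorem IsRandomSet.exists_castaing {Ω V : Type*} {H mΩ : MeasurableSpace Ω} (hH : H ≤ mΩ)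
    (μ : Measure Ω) [IsFiniteMeasure μ] [TopologicalSpace V] [PolishSpace V] [MeasurableSpace V]
    [BorelSpace V] [Nonempty V] {X : Ω → Set V} (hX : IsRandomSet H X) :
    ∃ (B : ℕ → Set Ω) (ξ : ℕ → Ω → V), (∀ n, MeasurableSet[H] (B n)) ∧ (∀ n, Measurable[H] (ξ n)) ∧
      (∀ n, ∀ ω ∈ B n, ξ n ω ∈ X ω) ∧
      ∀ᵐ ω ∂μ, X ω ⊆ closure {x | ∃ n, ω ∈ B n ∧ ξ n ω = x} := by
  obtain ⟨b, hbc, -, hb⟩ := exists_countable_basis V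
  have hbne : b.Nonempty := by
    obtain ⟨U, hU, -⟩ := hb.exists_subset_of_mem_open (mem_univ (Classical.arbitrary V)) isOpen_univ
    exact ⟨U, hU⟩
  obtain ⟨U, rfl⟩ := hbc.exists_eq_range hbne
  have hU : ∀ n, IsOpen (U n) := fun n => hb.isOpen (mem_range_self n)
  have hA : ∀ n, MeasurableSet[H.prod ‹_›] ({p : Ω × V | p.2 ∈ X p.1} ∩ {p | p.2 ∈ U n}) :=
    fun n => (isRandomSet_iff.1 hX).inter
      (@measurable_snd Ω V H _ _ (hU n).measurableSet)
  choose B ξ hB hξ hsel hae using fun n => exists_measurable_selection hH μ (hA n)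
  refine ⟨B, ξ, hB, hξ, fun n ω hω => (hsel n ω hω).1, ?_⟩
  filter_upwards [ae_all_iff.2 hae] with ω hω x hx
  rw [hb.mem_closure_iff]
  rintro _ ⟨n, rfl⟩ hxn
  have hωB : ω ∈ B n := by
    by_contra hcon
    exact hω n hcon x ⟨hx, hxn⟩
  exact ⟨ξ n ω, (hsel n ω hωB).2, n, hωB, rfl⟩

open Set in
/-- A Castaing representation of a random set in the weak dual of a separable Banach space. -/
theorem IsRandomSet.exists_castaing_weakDual {Ω E : Type*} {H mΩ : MeasurableSpace Ω} (hH : H ≤ mΩ)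
    (μ : Measure Ω) [IsFiniteMeasure μ] [NormedAddCommGroup E] [NormedSpace ℝ E]
    [SeparableSpace E] [MeasurableSpace (WeakDual ℝ E)] [BorelSpace (WeakDual ℝ E)]
    {X : Ω → Set (WeakDual ℝ E)} (hX : IsRandomSet H X) :
    ∃ (B : ℕ → Set Ω) (ξ : ℕ → Ω → WeakDual ℝ E), (∀ n, MeasurableSet[H] (B n)) ∧
      (∀ n, Measurable[H] (ξ n)) ∧ (∀ n, ∀ ω ∈ B n, ξ n ω ∈ X ω) ∧
      ∀ᵐ ω ∂μ, X ω ⊆ closure {x | ∃ n, ω ∈ B n ∧ ξ n ω = x} := by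
  -- The weak dual need not be Polish, but it is a countable union of dual balls, each weak-star
  -- compact and, by separability of `E`, metrizable.
  let S : ℕ → Set (WeakDual ℝ E) := fun k => WeakDual.toStrongDual ⁻¹' Metric.closedBall 0 k
  have hS : ∀ k, IsCompact (S k) := fun k => WeakDual.isCompact_closedBall 0 k
  have hpolish : ∀ k, PolishSpace (S k) := fun k => by
    have := WeakDual.metrizable_of_isCompact ℝ E (S k) (hS k)
    have := isCompact_iff_compactSpace.1 (hS k)
    let := metrizableSpaceMetric (S k)
    infer_instance
  have hne : ∀ k, Nonempty (S k) := fun k => ⟨⟨0, by simp [S]⟩⟩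
  choose B ξ hB hξ hsel hae using fun k => (hX.preimage
    (continuous_subtype_val (p := fun x => x ∈ S k))).exists_castaing hH μ
  refine ⟨fun n => B n.unpair.1 n.unpair.2, fun n ω => (ξ n.unpair.1 n.unpair.2 ω).1,
    fun n => hB _ _, fun n => measurable_subtype_coe.comp (hξ _ _), fun n ω hω => hsel _ _ ω hω, ?_⟩
  filter_upwards [ae_all_iff.2 hae] with ω hω x hx
  obtain ⟨k, hk⟩ := exists_nat_ge ‖WeakDual.toStrongDual x‖
  have hxk : x ∈ S k := by simpa [S] using hk
  have h1 := hω k (show (⟨x, hxk⟩ : S k) ∈ _ from hx)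
  rw [closure_subtype] at h1
  refine closure_mono ?_ h1
  rintro _ ⟨y, ⟨n, hn, rfl⟩, rfl⟩
  exact ⟨Nat.pair k n, by simpa using hn, by rw [Nat.unpair_pair]⟩

open Set in
/-- A Castaing representation of a random set containing the origin, by everywhere defined
selections. -/
theorem IsRandomSet.exists_castaing_of_zero_mem {Ω E : Type*} {H mΩ : MeasurableSpace Ω}
    (hH : H ≤ mΩ) (μ : Measure Ω) [IsFiniteMeasure μ] [TopologicalSpace E] [PolishSpace E]
    [MeasurableSpace E] [BorelSpace E] [Zero E] {X : Ω → Set E} (hX : IsRandomSet H X)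
    (h0 : ∀ᵐ ω ∂μ, 0 ∈ X ω) :
    ∃ ξ : ℕ → Ω → E, (∀ n, Measurable[H] (ξ n)) ∧ (∀ᵐ ω ∂μ, ∀ n, ξ n ω ∈ X ω) ∧
      ∀ᵐ ω ∂μ, X ω ⊆ closure (range fun n => ξ n ω) := by
  obtain ⟨B, ξ, hB, hξ, hsel, hae⟩ := hX.exists_castaing hH μ
  refine ⟨fun n => (B n).indicator (ξ n), fun n => (hξ n).indicator (hB n), ?_, ?_⟩
  · filter_upwards [h0] with ω hω n
    by_cases h : ω ∈ B n
    · simpa [h] using hsel n ω h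
    · simpa [h] using hω
  · filter_upwards [hae] with ω hω
    refine hω.trans (closure_mono ?_)
    rintro _ ⟨n, hn, rfl⟩
    exact ⟨n, by simp [hn]⟩

open Set in
/-- A random set containing the origin is almost surely contained in every random set that contains
its bounded measurable selections. -/
theorem IsRandomSet.ae_subset_of_forall_selection {Ω E : Type*} {H mΩ : MeasurableSpace Ω}
    (hH : H ≤ mΩ) (μ : Measure Ω) [IsFiniteMeasure μ] [NormedAddCommGroup E] [CompleteSpace E]
    [SeparableSpace E] [MeasurableSpace E] [BorelSpace E] {X Y : Ω → Set E} (hX : IsRandomSet H X)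
    (hY : IsRandomSet H Y) (h0 : ∀ᵐ ω ∂μ, 0 ∈ X ω)
    (h : ∀ (ξ : Ω → E) (r : ℝ), Measurable[H] ξ → (∀ ω, ‖ξ ω‖ ≤ r) → (∀ᵐ ω ∂μ, ξ ω ∈ X ω) →
      ∀ᵐ ω ∂μ, ξ ω ∈ Y ω) : ∀ᵐ ω ∂μ, X ω ⊆ Y ω := by
  obtain ⟨B, ξ, hB, hξ, hsel, hae⟩ :=
    exists_measurable_selection hH μ ((isRandomSet_iff.1 hX).diff (isRandomSet_iff.1 hY))
  have hn : ∀ n : ℕ, ∀ᵐ ω ∂μ, (B ∩ {ω | ‖ξ ω‖ ≤ n}).indicator ξ ω ∈ Y ω := by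
    intro n
    -- Truncating at norm `n` makes the selection bounded; off the event it is zero, which is still
    -- in `X`.
    refine h _ n (hξ.indicator (hB.inter (measurableSet_le (@Measurable.norm E Ω _ _ _ H _ hξ)
      (@measurable_const _ _ _ H _)))) ?_ ?_
    · intro ω
      by_cases hω : ω ∈ B ∩ {ω | ‖ξ ω‖ ≤ n}
      · rw [indicator_of_mem hω]; exact hω.2
      · rw [indicator_of_notMem hω]; simp
    · filter_upwards [h0] with ω h0
      by_cases hω : ω ∈ B ∩ {ω | ‖ξ ω‖ ≤ n}
      · rw [indicator_of_mem hω]; exact (hsel ω hω.1).1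
      · rw [indicator_of_notMem hω]; exact h0
  filter_upwards [ae_all_iff.2 hn, hae] with ω hω hωB x hx
  by_contra hxY
  refine hωB (fun hB => ?_) x ⟨hx, hxY⟩
  obtain ⟨n, hn⟩ := exists_nat_ge ‖ξ ω‖
  have := hω n
  rw [indicator_of_mem (show ω ∈ B ∩ {ω | ‖ξ ω‖ ≤ n} from ⟨hB, hn⟩)] at this
  exact (hsel ω hB).2 this

/-! ### Closed convex cones -/

section Cone

variable {V : Type*} [AddCommGroup V] [Module ℝ V] [TopologicalSpace V] {C : Set V}

theorem isClosedConvexCone_of_forall (hC : IsClosed C) (h0 : (0 : V) ∈ C)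
    (hadd : ∀ x ∈ C, ∀ y ∈ C, x + y ∈ C) (hsmul : ∀ t : ℝ, 0 ≤ t → ∀ x ∈ C, t • x ∈ C) :
    IsClosedConvexCone C :=
  ⟨{ carrier := C
     add_mem' := fun {x y} hx hy => hadd x hx y hy
     zero_mem' := h0
     smul_mem' := fun t x hx => hsmul t.1 t.2 x hx
     isClosed' := hC }, rfl⟩

namespace IsClosedConvexCone

theorem isClosed (h : IsClosedConvexCone C) : IsClosed C := by
  obtain ⟨P, rfl⟩ := h
  exact P.isClosed

theorem zero_mem (h : IsClosedConvexCone C) : (0 : V) ∈ C := by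
  obtain ⟨P, rfl⟩ := h
  exact P.zero_mem

theorem add_mem (h : IsClosedConvexCone C) {x y : V} (hx : x ∈ C) (hy : y ∈ C) : x + y ∈ C := by
  obtain ⟨P, rfl⟩ := h
  exact P.add_mem hx hy

theorem smul_mem (h : IsClosedConvexCone C) {t : ℝ} (ht : 0 ≤ t) {x : V} (hx : x ∈ C) :
    t • x ∈ C := by
  obtain ⟨P, rfl⟩ := h
  exact P.smul_mem hx ht

theorem convex (h : IsClosedConvexCone C) : Convex ℝ C := by
  obtain ⟨P, rfl⟩ := h
  exact P.convex

theorem finsuppSum_mem (h : IsClosedConvexCone C) {ι : Type*} {x : ι → V} (hx : ∀ i, x i ∈ C)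
    (a : ι →₀ NNRat) : (a.sum fun i q => (q : ℝ) • x i) ∈ C := by
  obtain ⟨P, rfl⟩ := h
  exact P.toSubmodule.sum_mem fun i _ => P.smul_mem (hx i) (by positivity)

end IsClosedConvexCone

/-- The closure of a set that is closed under addition and under multiplication by nonnegative
rational numbers is a closed convex cone. -/
theorem isClosedConvexCone_closure [IsTopologicalAddGroup V] [ContinuousSMul ℝ V] {D : Set V}
    (h0 : (0 : V) ∈ D) (hadd : ∀ x ∈ D, ∀ y ∈ D, x + y ∈ D)
    (hsmul : ∀ q : NNRat, ∀ x ∈ D, (q : ℝ) • x ∈ D) : IsClosedConvexCone (closure D) := by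
  refine isClosedConvexCone_of_forall isClosed_closure (subset_closure h0)
    (fun x hx y hy => map_mem_closure₂ continuous_add hx hy hadd) fun t ht x hx => ?_
  have h1 : t ∈ closure (Set.range fun q : NNRat => (q : ℝ)) := by
    rw [Metric.mem_closure_iff]
    intro ε hε
    obtain ⟨q, hq1, hq2⟩ := exists_rat_btwn (lt_add_of_pos_right t hε)
    have hq0 : 0 ≤ q := by exact_mod_cast ht.trans hq1.le
    refine ⟨q, ⟨⟨q, hq0⟩, rfl⟩, ?_⟩
    rw [Real.dist_eq, abs_sub_comm, abs_of_pos (by linarith)]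
    linarith
  refine map_mem_closure₂ continuous_smul h1 hx ?_
  rintro _ ⟨q, rfl⟩ y hy
  exact hsmul q y hy

theorem isClosedConvexCone_closure_range_finsuppSum [IsTopologicalAddGroup V]
    [ContinuousSMul ℝ V] {ι : Type*} (x : ι → V) : IsClosedConvexCone
      (closure (Set.range fun a : ι →₀ NNRat => a.sum fun i q => (q : ℝ) • x i)) := by
  classical
  refine isClosedConvexCone_closure ⟨0, by simp⟩ ?_ ?_
  · rintro _ ⟨a, rfl⟩ _ ⟨b, rfl⟩
    exact ⟨a + b, Finsupp.sum_add_index' (by simp) (by simp [add_smul])⟩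
  · rintro q _ ⟨a, rfl⟩
    refine ⟨q • a, ?_⟩
    simp only [Finsupp.smul_sum, smul_smul]
    rw [Finsupp.sum_smul_index (by simp)]
    simp

/-- The largest cone contained in a closed convex set which contains the origin. -/
theorem isClosedConvexCone_iInter [IsTopologicalAddGroup V] [ContinuousSMul ℝ V]
    (hC : IsClosed C) (hconv : Convex ℝ C) (h0 : (0 : V) ∈ C) :
    IsClosedConvexCone (⋂ n : ℕ, (fun x => ((n : ℝ) + 1) • x) ⁻¹' C) := by
  have key : ∀ x ∈ ⋂ n : ℕ, (fun x => ((n : ℝ) + 1) • x) ⁻¹' C, ∀ t : ℝ, 0 ≤ t → t • x ∈ C := by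
    intro x hx t ht
    obtain ⟨n, hn⟩ := exists_nat_ge t
    have hx' : ((n : ℝ) + 1) • x ∈ C := Set.mem_iInter.1 hx n
    have hpos : (0 : ℝ) < n + 1 := by positivity
    have := hconv.smul_mem_of_zero_mem h0 hx' (t := t / (n + 1))
      ⟨by positivity, by rw [div_le_one hpos]; linarith⟩
    rwa [smul_smul, div_mul_cancel₀ _ hpos.ne'] at this
  refine isClosedConvexCone_of_forall
    (isClosed_iInter fun n => hC.preimage (continuous_const_smul _)) (by simpa using h0)
    (fun x hx y hy => Set.mem_iInter.2 fun n => ?_) fun t ht x hx => Set.mem_iInter.2 fun n => ?_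
  -- The sum scaled by `n + 1` is the midpoint of `x` and `y` scaled by `2 * (n + 1)`.
  · have h1 := key x hx (2 * (n + 1)) (by positivity)
    have h2 := key y hy (2 * (n + 1)) (by positivity)
    have h3 := hconv h1 h2 (a := 1 / 2) (b := 1 / 2) (by norm_num) (by norm_num) (by norm_num)
    rw [Set.mem_preimage]
    convert h3 using 1
    module
  · rw [Set.mem_preimage, smul_smul]
    exact key x hx _ (by positivity)

end Cone

/-! ### Polarity and the bipolar theorems -/

section Polar

variable {E : Type*} [NormedAddCommGroup E] [NormedSpace ℝ E]

theorem posDual_antitone {C D : Set E} (h : C ⊆ D) : posDual D ⊆ posDual C :=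
  fun _ hu x hx => hu x (h hx)

theorem posPredual_antitone {C D : Set (WeakDual ℝ E)} (h : C ⊆ D) :
    posPredual D ⊆ posPredual C :=
  fun _ hx u hu => hx u (h hu)

theorem posDual_closure (C : Set E) : posDual (closure C) = posDual C := by
  refine (posDual_antitone subset_closure).antisymm fun u hu x hx => ?_
  have : IsClosed {x : E | 0 ≤ u x} := isClosed_le continuous_const (ContinuousLinearMap.continuous u)
  exact closure_minimal (fun y hy => hu y hy) this hx

theorem posPredual_closure (C : Set (WeakDual ℝ E)) : posPredual (closure C) = posPredual C := by
  refine (posPredual_antitone subset_closure).antisymm fun x hx u hu => ?_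
  have : IsClosed {u : WeakDual ℝ E | 0 ≤ u x} :=
    isClosed_le continuous_const (WeakDual.eval_continuous x)
  exact closure_minimal (fun y hy => hx y hy) this hu

theorem isClosed_posDual (C : Set E) : IsClosed (posDual C) := by
  simp only [posDual, Set.ofPred_forall]
  exact isClosed_biInter fun x _ => isClosed_le continuous_const (WeakDual.eval_continuous x)

theorem convex_posDual (C : Set E) : Convex ℝ (posDual C) := by
  intro u hu v hv a b ha hb _ x hx
  have h1 := hu x hx
  have h2 := hv x hx
  change 0 ≤ a * u x + b * v x
  positivity

theorem zero_mem_posDual (C : Set E) : 0 ∈ posDual C := fun _ _ => le_rfl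

theorem smul_mem_posDual {C : Set E} {u : WeakDual ℝ E} (hu : u ∈ posDual C) {t : ℝ} (ht : 0 ≤ t) :
    t • u ∈ posDual C := fun x hx => mul_nonneg ht (hu x hx)

/-- The **bipolar theorem** for closed convex cones in a normed space. -/
theorem IsClosedConvexCone.posPredual_posDual {C : Set E} (hC : IsClosedConvexCone C) :
    posPredual (posDual C) = C := by
  obtain ⟨P, rfl⟩ := hC
  refine Set.Subset.antisymm (fun x hx => ?_) fun x hx u hu => hu x hx
  by_contra hcon
  obtain ⟨f, hf, hfx⟩ := P.hyperplane_separation_point (x₀ := x) hcon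
  exact hfx.not_ge (hx (StrongDual.toWeakDual f) hf)

/-- The **bipolar theorem** for weak-star closed convex cones. -/
theorem IsClosedConvexCone.posDual_posPredual {C : Set (WeakDual ℝ E)}
    (hC : IsClosedConvexCone C) : posDual (posPredual C) = C := by
  obtain ⟨P, rfl⟩ := hC
  refine Set.Subset.antisymm (fun u hu => ?_) fun u hu x hx => hx u hu
  by_contra hcon
  have : LocallyConvexSpace ℝ (WeakDual ℝ E) :=
    inferInstanceAs (LocallyConvexSpace ℝ (WeakBilin (topDualPairing ℝ E)))
  have : ContinuousSMul ℝ (WeakDual ℝ E) :=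
    inferInstanceAs (ContinuousSMul ℝ (WeakBilin (topDualPairing ℝ E)))
  obtain ⟨f, hf, hfu⟩ := P.hyperplane_separation_point (x₀ := u) hcon
  -- Weak-star continuous functionals are evaluations, so the separating functional is a point of
  -- the predual.
  obtain ⟨x, rfl⟩ := LinearMap.dualEmbedding_surjective (topDualPairing ℝ E) f
  exact hfu.not_ge (hu x fun v hv => hf v hv)

end Polar

/-! ### Conditional distributions and conditional expectations -/

open ProbabilityTheory

/-- Almost sure properties of a pair of random elements, in terms of the conditional distribution of
the second one given the first one. -/
theorem ae_prodMk_mem_iff_ae_condDistrib {Ω β S : Type*} {mΩ : MeasurableSpace Ω}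
    {mβ : MeasurableSpace β} [MeasurableSpace S] [StandardBorelSpace S] [Nonempty S] {μ : Measure Ω}
    [IsFiniteMeasure μ] {X : Ω → β} {Y : Ω → S} (hX : Measurable X) (hY : AEMeasurable Y μ)
    {G : Set (β × S)} (hG : MeasurableSet G) :
    (∀ᵐ ω ∂μ, (X ω, Y ω) ∈ G) ↔ ∀ᵐ ω ∂μ, ∀ᵐ z ∂condDistrib Y X μ (X ω), (X ω, z) ∈ G := by
  have h1 := ae_map_iff (p := (· ∈ G)) (hX.aemeasurable.prodMk hY) hG
  rw [← h1, ← compProd_map_condDistrib hY, Measure.ae_compProd_iff (p := (· ∈ G)) hG, ae_map_iff hX.aemeasurable]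
  exact measurableSet_eq_fun (Kernel.measurable_kernel_prodMk_left hG.compl) measurable_const

/-- The conditional law of `ξ` given `X` is almost surely carried by the closed convex set `Z (X
ω)`, so its mean, the conditional expectation, lies there too. -/
theorem condExp_comap_mem_of_isRandomSet {Ω β E : Type*} {mΩ : MeasurableSpace Ω}
    {mβ : MeasurableSpace β} {μ : Measure Ω} [IsFiniteMeasure μ] [NormedAddCommGroup E]
    [NormedSpace ℝ E] [CompleteSpace E] [SeparableSpace E] {X : Ω → β} (hX : Measurable X)
    {Z : β → Set E} (hZ : IsRandomSet mβ Z) (hcl : ∀ᵐ ω ∂μ, IsClosed (Z (X ω)))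
    (hco : ∀ᵐ ω ∂μ, Convex ℝ (Z (X ω))) {ξ : Ω → E} (hξ : Integrable ξ μ)
    (hmem : ∀ᵐ ω ∂μ, ξ ω ∈ Z (X ω)) : ∀ᵐ ω ∂μ, (μ[ξ | mβ.comap X]) ω ∈ Z (X ω) := by
  borelize E
  have := UniformSpace.secondCountable_of_separable E
  have h1 := (ae_prodMk_mem_iff_ae_condDistrib hX hξ.aemeasurable (isRandomSet_iff.1 hZ)).1 hmem
  have h2 : Integrable (fun p : β × E => p.2) (μ.map fun ω => (X ω, ξ ω)) :=
    (integrable_map_measure measurable_snd.aestronglyMeasurable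
      (hX.aemeasurable.prodMk hξ.aemeasurable)).2 hξ
  filter_upwards [hcl, hco, h1, condExp_ae_eq_integral_condDistrib' hX hξ,
    h2.condDistrib_ae hX.aemeasurable hξ.aemeasurable] with ω hcl hco h1 h2 h3
  rw [h2]
  exact hco.integral_mem hcl h1 h3

/-- The conditional expectation of a selection of a measurable random closed convex set is again a
selection of it. -/
theorem IsRandomSet.condExp_mem {Ω E : Type*} {H mΩ : MeasurableSpace Ω} (hH : H ≤ mΩ)
    {μ : Measure Ω} [IsFiniteMeasure μ] [NormedAddCommGroup E]
    [NormedSpace ℝ E] [CompleteSpace E] [SeparableSpace E] {Z : Ω → Set E} (hZ : IsRandomSet H Z)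
    (hcl : ∀ᵐ ω ∂μ, IsClosed (Z ω)) (hco : ∀ᵐ ω ∂μ, Convex ℝ (Z ω)) {ξ : Ω → E}
    (hξ : Integrable ξ μ) (hmem : ∀ᵐ ω ∂μ, ξ ω ∈ Z ω) : ∀ᵐ ω ∂μ, (μ[ξ | H]) ω ∈ Z ω := by
  have := condExp_comap_mem_of_isRandomSet (X := id) (measurable_id'' hH) hZ hcl hco hξ hmem
  rwa [MeasurableSpace.comap_id] at this

/-- This is the form in which the conditional core is constructed; the kernel mass of the
exceptional sequences depends measurably on `(b, x)`. -/
theorem isRandomSet_ae_mem_closure_range {β E : Type*} {mβ : MeasurableSpace β}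
    [PseudoEMetricSpace E] [SecondCountableTopology E] [MeasurableSpace E] [BorelSpace E]
    (κ : Kernel β (ℕ → E)) [IsSFiniteKernel κ] :
    IsRandomSet mβ fun b => {x | ∀ᵐ z ∂κ b, x ∈ closure (Set.range z)} := by
  rw [isRandomSet_iff]
  have h1 := isRandomSet_iff.1
    (isRandomSet_closure_range (c := fun (n : ℕ) (z : ℕ → E) => z n) measurable_pi_apply)
  have h2 : MeasurableSet {p : (β × E) × (ℕ → E) | p.1.2 ∉ closure (Set.range p.2)} :=
    ((measurable_snd.prodMk (measurable_snd.comp measurable_fst)) h1).compl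
  exact Kernel.measurable_kernel_prodMk_left (κ := κ.comap Prod.fst measurable_fst) h2
    (measurableSet_singleton 0)

/-! ### The conditional core -/

section Core

variable {Ω E : Type*} {H mΩ : MeasurableSpace Ω} {μ : Measure Ω} [IsFiniteMeasure μ]
  [NormedAddCommGroup E] [NormedSpace ℝ E] [CompleteSpace E] [SeparableSpace E] {K : Ω → Set E}

theorem exists_isCondCore (hH : H ≤ mΩ) (hK : IsRandomSet mΩ K)
    (hcone : ∀ᵐ ω ∂μ, IsClosedConvexCone (K ω)) : ∃ m, IsCondCore H μ K m := by
  borelize E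
  have := UniformSpace.secondCountable_of_separable E
  obtain ⟨ξ, hξ, hξK, hKξ⟩ :=
    hK.exists_castaing_of_zero_mem le_rfl μ (hcone.mono fun ω h => h.zero_mem)
  have hKeq : ∀ᵐ ω ∂μ, closure (Set.range fun n => ξ n ω) = K ω := by
    filter_upwards [hcone, hξK, hKξ] with ω h1 h2 h3
    exact (closure_minimal (Set.range_subset_iff.2 h2) h1.isClosed).antisymm h3
  let Ξ : Ω → ℕ → E := fun ω n => ξ n ω
  have hΞ : Measurable[mΩ] Ξ := measurable_pi_lambda _ hξ
  let κ := @condDistrib Ω Ω (ℕ → E) _ _ _ mΩ H Ξ id μ _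
  let m : Ω → Set E := fun ω => {x | ∀ᵐ z ∂κ ω, x ∈ closure (Set.range z)}
  have hm : IsRandomSet H m := isRandomSet_ae_mem_closure_range κ
  -- Disintegrating the law of the pair of the identity (into `H`) and `Ξ` turns selections of `K`
  -- into selections of `m`.
  have hiff : ∀ ζ : Ω → E, Measurable[H] ζ → ((∀ᵐ ω ∂μ, ζ ω ∈ K ω) ↔ ∀ᵐ ω ∂μ, ζ ω ∈ m ω) := by
    intro ζ hζ
    have hG : MeasurableSet[H.prod MeasurableSpace.pi] {p : Ω × (ℕ → E) | ζ p.1 ∈ closure (Set.range p.2)} := by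
      have h1 := isRandomSet_iff.1
        (isRandomSet_closure_range (c := fun (n : ℕ) (z : ℕ → E) => z n) measurable_pi_apply)
      exact (Measurable.prodMk (@measurable_snd Ω (ℕ → E) H _)
        (hζ.comp (@measurable_fst Ω (ℕ → E) H _))) h1
    refine Iff.trans ?_
      (ae_prodMk_mem_iff_ae_condDistrib (measurable_id'' hH) hΞ.aemeasurable hG)
    refine Filter.eventually_congr ?_
    filter_upwards [hKeq] with ω hω
    rw [← hω]
    rfl
  have hm0 : ∀ᵐ ω ∂μ, 0 ∈ m ω :=
    (hiff (fun _ => 0) (@measurable_const _ _ _ H 0)).1 (hcone.mono fun ω h => h.zero_mem)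
  refine ⟨m, hm, ?_, fun Z hZ hZK => ?_⟩
  · obtain ⟨ζ, hζ, hζm, hmζ⟩ := hm.exists_castaing_of_zero_mem hH μ hm0
    have h1 : ∀ᵐ ω ∂μ, ∀ n, ζ n ω ∈ K ω :=
      ae_all_iff.2 fun n => (hiff _ (hζ n)).2 (hζm.mono fun ω h => h n)
    filter_upwards [h1, hmζ, hcone] with ω h1 h2 h3
    exact h2.trans (closure_minimal (Set.range_subset_iff.2 h1) h3.isClosed)
  -- `Z` may have empty values; adding the origin keeps it inside `K` and gives everywhere defined
  -- selections.
  · have := hZ.insert_zero.ae_subset_of_forall_selection hH μ hm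
      (.of_forall fun ω => Set.mem_insert _ _) fun ζ r hζ _ hmem => (hiff ζ hζ).1 ?_
    · exact this.mono fun ω h => (Set.subset_insert _ _).trans h
    · filter_upwards [hmem, hZK, hcone] with ω h1 h2 h3
      rcases h1 with h1 | h1
      · rw [h1]; exact h3.zero_mem
      · exact h2 h1

/-- The conditional core of a random closed convex cone is a closed convex cone. -/
theorem IsCondCore.isClosedConvexCone (hH : H ≤ mΩ)
    (hcone : ∀ᵐ ω ∂μ, IsClosedConvexCone (K ω)) {m : Ω → Set E} (hm : IsCondCore H μ K m) :
    ∀ᵐ ω ∂μ, IsClosedConvexCone (m ω) := by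
  borelize E
  have := UniformSpace.secondCountable_of_separable E
  have hm0 : ∀ᵐ ω ∂μ, 0 ∈ m ω := by
    have h1 : IsRandomSet H fun _ : Ω => insert (0 : E) ∅ :=
      IsRandomSet.insert_zero (X := fun _ => ∅) (by simp [IsRandomSet])
    filter_upwards [hm.largest _ h1 (hcone.mono fun ω h => by simpa using h.zero_mem)] with ω h
    exact h (Set.mem_insert _ _)
  obtain ⟨ζ, hζ, hζm, hmζ⟩ := hm.measurable.exists_castaing_of_zero_mem hH μ hm0
  -- The closed cone generated by the selections of `m` is `H`-measurable and stays inside `K`, so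
  -- maximality puts it inside `m`.
  have hM := isRandomSet_closure_range (H := H)
    (c := fun (a : ℕ →₀ NNRat) ω => a.sum fun n q => (q : ℝ) • ζ n ω)
    fun a => Finset.measurable_fun_sum _ fun n _ => (hζ n).const_smul _
  have hMK : ∀ᵐ ω ∂μ,
      closure (Set.range fun a : ℕ →₀ NNRat => a.sum fun n q => (q : ℝ) • ζ n ω) ⊆ K ω := by
    filter_upwards [hcone, hζm, hm.subset] with ω h1 h2 h3
    refine closure_minimal ?_ h1.isClosed
    rintro _ ⟨a, rfl⟩
    exact h1.finsuppSum_mem (fun n => h3 (h2 n)) a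
  filter_upwards [hm.largest _ hM hMK, hmζ] with ω h1 h2
  have : m ω = closure (Set.range fun a : ℕ →₀ NNRat => a.sum fun n q => (q : ℝ) • ζ n ω) := by
    refine (h2.trans (closure_mono ?_)).antisymm h1
    rintro _ ⟨n, rfl⟩
    exact ⟨Finsupp.single n 1, by simp⟩
  rw [this]
  exact isClosedConvexCone_closure_range_finsuppSum _

end Core

/-! ### Uniqueness of versions -/

theorem IsCondCore.ae_eq {Ω V : Type*} [TopologicalSpace V] {H mΩ : MeasurableSpace Ω}
    {μ : Measure Ω} {X m m' : Ω → Set V} (hm : IsCondCore H μ X m) (hm' : IsCondCore H μ X m') :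
    ∀ᵐ ω ∂μ, m ω = m' ω := by
  filter_upwards [hm'.largest m hm.measurable hm.subset,
    hm.largest m' hm'.measurable hm'.subset] with ω h1 h2
  exact h1.antisymm h2

theorem IsCondHull.ae_eq {Ω V : Type*} [AddCommGroup V] [Module ℝ V] [TopologicalSpace V]
    {H mΩ : MeasurableSpace Ω} {μ : Measure Ω} {X M M' : Ω → Set V} (hM : IsCondHull H μ X M)
    (hM' : IsCondHull H μ X M') : ∀ᵐ ω ∂μ, M ω = M' ω := by
  filter_upwards [hM.smallest M' hM'.measurable hM'.closed hM'.convex hM'.subset,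
    hM'.smallest M hM.measurable hM.closed hM.convex hM.subset] with ω h1 h2
  exact h1.antisymm h2

/-! ### The hull of the dual cone -/

section DualHull

variable {Ω E : Type*} {H mΩ : MeasurableSpace Ω} {μ : Measure Ω} [IsFiniteMeasure μ]
  [NormedAddCommGroup E] [NormedSpace ℝ E] [SeparableSpace E] {K : Ω → Set E}

/-- If a random weak-star closed convex set contains the dual of `K`, then it contains the dual of
the conditional core of `K`. -/
theorem IsCondCore.posDual_subset (hH : H ≤ mΩ)
    (hcone : ∀ᵐ ω ∂μ, IsClosedConvexCone (K ω)) {m : Ω → Set E} (hm : IsCondCore H μ K m)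
    {Z : Ω → Set (WeakDual ℝ E)} (hZ : IsRandomSet H Z) (hcl : ∀ᵐ ω ∂μ, IsClosed (Z ω))
    (hco : ∀ᵐ ω ∂μ, Convex ℝ (Z ω)) (hKZ : ∀ᵐ ω ∂μ, posDual (K ω) ⊆ Z ω) :
    ∀ᵐ ω ∂μ, posDual (m ω) ⊆ Z ω := by
  borelize (WeakDual ℝ E)
  have : ContinuousSMul ℝ (WeakDual ℝ E) :=
    inferInstanceAs (ContinuousSMul ℝ (WeakBilin (topDualPairing ℝ E)))
  -- The largest cone inside `Z`, cut out by countably many dilations so that it stays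
  -- `H`-measurable.
  let Z' : Ω → Set (WeakDual ℝ E) := fun ω => ⋂ n : ℕ, (fun u => ((n : ℝ) + 1) • u) ⁻¹' Z ω
  have hZ' : IsRandomSet H Z' :=
    IsRandomSet.iInter fun n => hZ.preimage (continuous_const_smul ((n : ℝ) + 1))
  obtain ⟨B, u, hB, hu, huZ, hZu⟩ := hZ'.exists_castaing_weakDual hH μ
  have hZ'cone : ∀ᵐ ω ∂μ, IsClosedConvexCone (Z' ω) := by
    filter_upwards [hcl, hco, hKZ] with ω h1 h2 h3
    exact isClosedConvexCone_iInter h1 h2 (h3 (zero_mem_posDual _))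
  have hW : IsRandomSet H fun ω => posPredual {v | ∃ n, ω ∈ B n ∧ u n ω = v} :=
    isRandomSet_posPredual_range (H := H) hB hu
  have hWeq : ∀ᵐ ω ∂μ, posPredual {v | ∃ n, ω ∈ B n ∧ u n ω = v} = posPredual (Z' ω) := by
    filter_upwards [hZu] with ω h
    refine Set.Subset.antisymm ?_ (posPredual_antitone ?_)
    · rw [← posPredual_closure]
      exact posPredual_antitone h
    · rintro _ ⟨n, hn, rfl⟩
      exact huZ n ω hn
  have hWK : ∀ᵐ ω ∂μ, posPredual {v | ∃ n, ω ∈ B n ∧ u n ω = v} ⊆ K ω := by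
    filter_upwards [hWeq, hKZ, hcone] with ω h1 h2 h3
    rw [h1, ← h3.posPredual_posDual]
    refine posPredual_antitone fun v hv => Set.mem_iInter.2 fun n => h2 ?_
    exact smul_mem_posDual hv (by positivity)
  filter_upwards [hm.largest _ hW hWK, hWeq, hZ'cone] with ω h1 h2 h3
  rw [h2] at h1
  refine (posDual_antitone h1).trans ?_
  rw [h3.posDual_posPredual]
  exact (Set.iInter_subset _ 0).trans (by simp)

/-- The dual of the conditional core of `K` is a version of the conditional convex hull of the dual
of `K`. -/
theorem IsCondCore.exists_isCondHull_posDual [CompleteSpace E] (hH : H ≤ mΩ)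
    (hcone : ∀ᵐ ω ∂μ, IsClosedConvexCone (K ω)) {m : Ω → Set E} (hm : IsCondCore H μ K m) :
    ∃ N, IsCondHull H μ (fun ω => posDual (K ω)) N ∧ ∀ᵐ ω ∂μ, N ω = posDual (m ω) := by
  borelize E
  have := UniformSpace.secondCountable_of_separable E
  obtain ⟨ζ, hζ, hζm, hmζ⟩ := hm.measurable.exists_castaing_of_zero_mem hH μ
    ((hm.isClosedConvexCone hH hcone).mono fun ω h => h.zero_mem)
  have hN : ∀ᵐ ω ∂μ, posDual (Set.range fun n => ζ n ω) = posDual (m ω) := by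
    filter_upwards [hζm, hmζ] with ω h1 h2
    refine Set.Subset.antisymm ?_ (posDual_antitone (Set.range_subset_iff.2 h1))
    rw [← posDual_closure]
    exact posDual_antitone h2
  refine ⟨_, ⟨isRandomSet_posDual_range (H := H) hζ, .of_forall fun _ => isClosed_posDual _,
    .of_forall fun _ => convex_posDual _, ?_, fun Z hZ hcl hco hKZ => ?_⟩, hN⟩
  · filter_upwards [hN, hm.subset] with ω h1 h2
    rw [h1]
    exact posDual_antitone h2
  · filter_upwards [hN, hm.posDual_subset hH hcone hZ hcl hco hKZ] with ω h1 h2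
    rwa [h1]

end DualHull

/-! ### Generating the hull by conditional expectations -/

section Hull

variable {Ω E : Type*} {H mΩ : MeasurableSpace Ω} {μ : Measure Ω} [IsFiniteMeasure μ]
  [NormedAddCommGroup E] [NormedSpace ℝ E] [CompleteSpace E]

/-- If `ξ` stays in a ball on the event `A`, then a cone containing the conditional expectation of
`ξ` restricted to `A` meets this ball almost surely on `A`. -/
theorem ae_notMem_of_condExp_indicator_mem (hH : H ≤ mΩ) {A C : Set Ω} (hA : MeasurableSet[mΩ] A)
    (hC : MeasurableSet[H] C) {ξ : Ω → E} (hξ : Integrable ξ μ) {M : Ω → Set E}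
    (hM : ∀ᵐ ω ∂μ, IsClosedConvexCone (M ω)) (hmem : ∀ᵐ ω ∂μ, (μ[A.indicator ξ | H]) ω ∈ M ω)
    {x : E} {r : ℝ} (hAr : ∀ ω ∈ A, ‖ξ ω - x‖ ≤ r) (hCr : ∀ ω ∈ C, ∀ y ∈ M ω, r < ‖y - x‖) :
    ∀ᵐ ω ∂μ, ω ∈ A → ω ∉ C := by
  have h1int : Integrable (A.indicator fun _ => (1 : ℝ)) μ := (integrable_const 1).indicator hA
  set p := μ[A.indicator fun _ => (1 : ℝ) | H] with hp
  have hp0 : 0 ≤ᵐ[μ] p := condExp_nonneg (.of_forall fun ω => Set.indicator_nonneg (by simp) ω)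
  have hx : (fun ω => p ω • x) =ᵐ[μ] μ[A.indicator fun _ => x | H] := by
    have := ContinuousLinearMap.comp_condExp_comm (m := H) h1int
      (ContinuousLinearMap.toSpanSingleton ℝ x)
    have h2 : ContinuousLinearMap.toSpanSingleton ℝ x ∘ A.indicator (fun _ => (1 : ℝ)) =
        A.indicator fun _ => x := by
      funext ω
      by_cases h : ω ∈ A <;> simp [h]
    rw [h2] at this
    exact this
  have hsub : μ[A.indicator fun ω => ξ ω - x | H] =ᵐ[μ]
      fun ω => (μ[A.indicator ξ | H]) ω - p ω • x := by
    have h2 : A.indicator (fun ω => ξ ω - x) = A.indicator ξ - A.indicator fun _ => x :=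
      Set.indicator_sub A ξ fun _ => x
    rw [h2]
    filter_upwards [condExp_sub (hξ.indicator hA)
      ((integrable_const x).indicator hA) H, hx] with ω h3 h4
    rw [h3, h4]
    rfl
  have hr : μ[fun ω => ‖A.indicator (fun ω => ξ ω - x) ω‖ | H] ≤ᵐ[μ] fun ω => r * p ω := by
    have h2 : μ[r • A.indicator fun _ => (1 : ℝ) | H] =ᵐ[μ] r • p := condExp_smul r _ H
    refine (condExp_mono ?_ (h1int.smul r) (.of_forall fun ω => ?_)).trans h2.le
    · exact ((hξ.sub (integrable_const x)).indicator hA).norm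
    · by_cases h : ω ∈ A
      · simpa [h] using hAr ω h
      · simp [h]
  -- Where `p` is positive, dividing by it keeps the conditional expectation in the cone and brings
  -- it within `r` of `x`, which `C` excludes.
  have hpC : ∀ᵐ ω ∂μ, ω ∈ C → p ω = 0 := by
    filter_upwards [hp0, hsub, hr, hM, hmem,
      norm_condExp_le (m := H) (μ := μ) (A.indicator fun ω => ξ ω - x)] with ω h0 h1 h2 h3 h4 h5 hωC
    by_contra hne
    have hpos : 0 < p ω := lt_of_le_of_ne h0 (Ne.symm hne)
    have h6 : ‖(μ[A.indicator ξ | H]) ω - p ω • x‖ ≤ r * p ω := by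
      rw [← h1]
      exact h5.trans h2
    have h7 := hCr ω hωC _ (h3.smul_mem (inv_nonneg.2 hpos.le) h4)
    have h8 : (p ω)⁻¹ • (μ[A.indicator ξ | H]) ω - x =
        (p ω)⁻¹ • ((μ[A.indicator ξ | H]) ω - p ω • x) := by
      rw [smul_sub, inv_smul_smul₀ hne]
    rw [h8, norm_smul, Real.norm_of_nonneg (inv_nonneg.2 hpos.le), inv_mul_eq_div,
      lt_div_iff₀ hpos] at h7
    exact h7.not_ge h6
  have hint : ∫ ω in C, A.indicator (fun _ => (1 : ℝ)) ω ∂μ = 0 := by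
    rw [← setIntegral_condExp hH h1int hC]
    exact setIntegral_eq_zero_of_ae_eq_zero hpC
  rw [integral_indicator hA, Measure.restrict_restrict hA, setIntegral_const, smul_eq_mul, mul_one,
    measureReal_eq_zero_iff] at hint
  filter_upwards [measure_eq_zero_iff_ae_notMem.1 hint] with ω hω hωA hωC
  exact hω ⟨hωA, hωC⟩

variable [SeparableSpace E] {K : Ω → Set E}

/-- Countably many conditional expectations of selections of a random closed convex cone whose
values form, up to closure, a cone containing it. -/
theorem exists_condExp_selections (hH : H ≤ mΩ) [MeasurableSpace E] [BorelSpace E]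
    (hK : IsRandomSet mΩ K) (hcone : ∀ᵐ ω ∂μ, IsClosedConvexCone (K ω)) :
    ∃ c : ℕ → Ω → E, (∀ n, Measurable[H] (c n)) ∧
      (∀ n, ∃ ζ : Ω → E, Integrable ζ μ ∧ (∀ᵐ ω ∂μ, ζ ω ∈ K ω) ∧ μ[ζ | H] =ᵐ[μ] c n) ∧
      (∀ ω, IsClosedConvexCone (closure (Set.range fun n => c n ω))) ∧
      ∀ᵐ ω ∂μ, K ω ⊆ closure (Set.range fun n => c n ω) := by
  have := UniformSpace.secondCountable_of_separable E
  obtain ⟨ξ, hξ, hξK, hKξ⟩ :=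
    hK.exists_castaing_of_zero_mem le_rfl μ (hcone.mono fun ω h => h.zero_mem)
  let x := denseSeq E
  -- For `(n, j, k)`, the event that `ξ n` is within `1 / (k + 1)` of the dense point `x j`.
  let A : ℕ × ℕ × ℕ → Set Ω := fun i => {ω | ‖ξ i.1 ω - x i.2.1‖ ≤ 1 / ((i.2.2 : ℝ) + 1)}
  have hA : ∀ i, MeasurableSet[mΩ] (A i) := fun i =>
    measurableSet_le ((hξ i.1).sub_const _).norm measurable_const
  let g : ℕ × ℕ × ℕ → Ω → E := fun i => (A i).indicator (ξ i.1)
  have hg : ∀ i, Integrable (g i) μ := fun i => by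
    refine Integrable.of_bound ((hξ i.1).indicator (hA i)).aestronglyMeasurable
      (1 / ((i.2.2 : ℝ) + 1) + ‖x i.2.1‖) (.of_forall fun ω => ?_)
    by_cases h : ω ∈ A i
    · have h1 : ‖ξ i.1 ω - x i.2.1‖ ≤ 1 / ((i.2.2 : ℝ) + 1) := h
      have h2 := norm_add_le (ξ i.1 ω - x i.2.1) (x i.2.1)
      rw [sub_add_cancel] at h2
      simp only [g, Set.indicator_of_mem h]
      linarith
    · simp only [g, Set.indicator_of_notMem h, norm_zero]
      positivity
  have hgK : ∀ᵐ ω ∂μ, ∀ i, g i ω ∈ K ω := by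
    filter_upwards [hξK, hcone] with ω h1 h2 i
    by_cases h : ω ∈ A i
    · simpa only [g, Set.indicator_of_mem h] using h1 i.1
    · simpa only [g, Set.indicator_of_notMem h] using h2.zero_mem
  let c : (ℕ × ℕ × ℕ →₀ NNRat) → Ω → E := fun a ω => a.sum fun i q => (q : ℝ) • (μ[g i | H]) ω
  have hc : ∀ a, Measurable[H] (c a) := fun a => Finset.measurable_fun_sum _ fun i _ =>
    stronglyMeasurable_condExp.measurable.const_smul (a i : ℝ)
  have hcone' : ∀ ω, IsClosedConvexCone (closure (Set.range fun a => c a ω)) := fun ω =>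
    isClosedConvexCone_closure_range_finsuppSum _
  have hcζ : ∀ a, ∃ ζ : Ω → E, Integrable ζ μ ∧ (∀ᵐ ω ∂μ, ζ ω ∈ K ω) ∧ μ[ζ | H] =ᵐ[μ] c a := by
    intro a
    refine ⟨∑ i ∈ a.support, (a i : ℝ) • g i, integrable_finsetSum' _ fun i _ => (hg i).smul _,
      ?_, ?_⟩
    · filter_upwards [hgK, hcone] with ω h1 h2
      simpa [Finsupp.sum] using h2.finsuppSum_mem h1 a
    · have h1 : ∀ᵐ ω ∂μ, ∀ i, (μ[(a i : ℝ) • g i | H]) ω = (a i : ℝ) • (μ[g i | H]) ω :=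
        ae_all_iff.2 fun i => condExp_smul (a i : ℝ) (g i) H
      filter_upwards [condExp_finsetSum (fun i (_ : i ∈ a.support) => (hg i).smul (a i : ℝ)) H,
        h1] with ω h2 h3
      rw [h2]
      simp [c, Finsupp.sum, h3]
  have hmem : ∀ i ω, (μ[g i | H]) ω ∈ closure (Set.range fun a => c a ω) := fun i ω =>
    subset_closure ⟨Finsupp.single i 1, by simp [c]⟩
  have hKc : ∀ᵐ ω ∂μ, K ω ⊆ closure (Set.range fun a => c a ω) := by
    -- The doubled radius gives a non-strict bound that survives closure and still strictly exceeds
    -- `1 / (k + 1)`.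
    have hnot : ∀ i, ∀ᵐ ω ∂μ, ω ∈ A i →
        ω ∉ {ω | ∀ a, 2 / ((i.2.2 : ℝ) + 1) ≤ ‖c a ω - x i.2.1‖} := by
      intro i
      have hpos : (0 : ℝ) < 1 / ((i.2.2 : ℝ) + 1) := by positivity
      have hint : (A i).indicator (g i) = g i := by simp [g]
      refine ae_notMem_of_condExp_indicator_mem hH (hA i) ?_ (hg i) (.of_forall hcone')
        (.of_forall fun ω => ?_) (x := x i.2.1) (r := 1 / ((i.2.2 : ℝ) + 1)) ?_ ?_
      · simp only [Set.ofPred_forall]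
        exact @MeasurableSet.iInter _ _ H _ _ fun a =>
          (measurable_norm.comp ((hc a).sub_const (x i.2.1))) measurableSet_Ici
      · rw [hint]
        exact hmem i ω
      · intro ω hω
        simp only [g, Set.indicator_of_mem hω]
        exact hω
      · intro ω hω y hy
        have hcl : IsClosed {y : E | 2 / ((i.2.2 : ℝ) + 1) ≤ ‖y - x i.2.1‖} :=
          isClosed_le continuous_const (by fun_prop)
        have hsub : (Set.range fun a => c a ω) ⊆
            {y : E | 2 / ((i.2.2 : ℝ) + 1) ≤ ‖y - x i.2.1‖} := Set.range_subset_iff.2 hω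
        have h1 : 2 / ((i.2.2 : ℝ) + 1) ≤ ‖y - x i.2.1‖ := closure_minimal hsub hcl hy
        refine lt_of_lt_of_le ?_ h1
        gcongr
        norm_num
    filter_upwards [hKξ, ae_all_iff.2 hnot] with ω h1 h2
    refine h1.trans (closure_minimal ?_ isClosed_closure)
    rintro _ ⟨n, rfl⟩
    rw [Metric.mem_closure_iff]
    intro ε hε
    obtain ⟨k, hk⟩ := exists_nat_one_div_lt (show 0 < ε / 3 by positivity)
    obtain ⟨j, hj⟩ := (denseRange_denseSeq E).exists_dist_lt (ξ n ω)
      (show (0 : ℝ) < 1 / ((k : ℝ) + 1) by positivity)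
    have h3 := h2 (n, j, k) (by
      rw [dist_eq_norm] at hj
      exact hj.le)
    simp only [not_forall, not_le] at h3
    obtain ⟨a, ha⟩ := h3
    refine ⟨c a ω, ⟨a, rfl⟩, ?_⟩
    have h4 : dist (x j) (c a ω) < 2 / ((k : ℝ) + 1) := by rwa [dist_comm, dist_eq_norm]
    have h5 : 2 / ((k : ℝ) + 1) = 2 * (1 / ((k : ℝ) + 1)) := by ring
    have h6 := dist_triangle (ξ n ω) (x j) (c a ω)
    have h7 : dist (ξ n ω) (x j) < 1 / ((k : ℝ) + 1) := hj
    linarith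
  obtain ⟨e, he⟩ := exists_surjective_nat (ℕ × ℕ × ℕ →₀ NNRat)
  have hrange : ∀ ω, (Set.range fun n => c (e n) ω) = Set.range fun a => c a ω := fun ω =>
    he.range_comp fun a => c a ω
  refine ⟨fun n => c (e n), fun n => hc _, fun n => hcζ _, fun ω => ?_, ?_⟩
  · rw [hrange]; exact hcone' ω
  · simpa only [hrange] using hKc

end Hull

/-! ### The conditional selection expectation -/

section Expectation

variable {Ω E : Type*} {H mΩ : MeasurableSpace Ω} {μ : Measure Ω} [NormedAddCommGroup E]

/-- Convergence in `L¹` gives almost sure convergence along a subsequence, and the values of `X` are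
closed. -/
theorem isClosed_integrableSelections [CompleteSpace E] (hH : H ≤ mΩ) {X : Ω → Set E}
    (hX : ∀ᵐ ω ∂μ, IsClosed (X ω)) : IsClosed (integrableSelections H μ X) := by
  refine (isClosed_aestronglyMeasurable hH).inter (IsSeqClosed.isClosed fun f g hf hg => ?_)
  obtain ⟨φ, -, hφ⟩ := (tendstoInMeasure_of_tendsto_Lp hg).exists_seq_tendsto_ae
  have h1 : ∀ᵐ ω ∂μ, ∀ n, f n ω ∈ X ω := ae_all_iff.2 hf
  filter_upwards [hX, hφ, h1] with ω h1 h2 h3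
  exact h1.mem_of_tendsto h2 (.of_forall fun n => h3 _)

/-- A random set containing the origin is determined by its integrable selections. -/
theorem ae_subset_of_integrableSelections_subset [IsFiniteMeasure μ] [CompleteSpace E]
    [SeparableSpace E] (hH : H ≤ mΩ) {X Y : Ω → Set E} (hX : IsRandomSet H X)
    (hY : IsRandomSet H Y) (h0 : ∀ᵐ ω ∂μ, 0 ∈ X ω)
    (h : integrableSelections H μ X ⊆ integrableSelections H μ Y) : ∀ᵐ ω ∂μ, X ω ⊆ Y ω := by
  borelize E
  have := UniformSpace.secondCountable_of_separable E
  refine hX.ae_subset_of_forall_selection hH μ hY h0 fun ξ r hξ hr hmem => ?_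
  have hint : Integrable ξ μ :=
    .of_bound (hξ.mono hH le_rfl).aestronglyMeasurable r (.of_forall hr)
  have hsel : hint.toL1 ξ ∈ integrableSelections H μ X := by
    refine ⟨AEStronglyMeasurable.congr
      hξ.stronglyMeasurable.aestronglyMeasurable hint.coeFn_toL1.symm, ?_⟩
    filter_upwards [hint.coeFn_toL1, hmem] with ω h1 h2
    rwa [h1]
  filter_upwards [hint.coeFn_toL1, (h hsel).2] with ω h1 h2
  rwa [h1] at h2

variable [NormedSpace ℝ E] [CompleteSpace E] {K : Ω → Set E}

/-- Two conditional expectations of selections of `K` can be glued along an event of `H`. -/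
theorem exists_condExp_piecewise (hH : H ≤ mΩ) {D : Set Ω} (hD : MeasurableSet[H] D)
    {ξ ζ : Ω → E} (hξ : Integrable ξ μ) (hζ : Integrable ζ μ) (hξK : ∀ᵐ ω ∂μ, ξ ω ∈ K ω)
    (hζK : ∀ᵐ ω ∂μ, ζ ω ∈ K ω) :
    ∃ η : Ω → E, Integrable η μ ∧ (∀ᵐ ω ∂μ, η ω ∈ K ω) ∧
      ∀ᵐ ω ∂μ, (ω ∈ D → (μ[η | H]) ω = (μ[ξ | H]) ω) ∧
        (ω ∉ D → (μ[η | H]) ω = (μ[ζ | H]) ω) := by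
  have hξ' := hξ.indicator (hH _ hD)
  have hζ' := hζ.indicator (hH _ hD.compl)
  refine ⟨D.indicator ξ + Dᶜ.indicator ζ, hξ'.add hζ', ?_, ?_⟩
  · filter_upwards [hξK, hζK] with ω h1 h2
    by_cases h : ω ∈ D <;> simpa [h]
  · filter_upwards [condExp_add hξ' hζ' H, condExp_indicator hξ hD,
      condExp_indicator hζ hD.compl] with ω h1 h2 h3
    rw [h1, Pi.add_apply, h2, h3]
    constructor <;> intro h <;> simp [h]

/-- An integrable `H`-measurable map with values in the closure of countably many conditional
expectations of selections of `K` is a limit in `L¹` of conditional expectations of selections. -/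
theorem mem_closure_condExp_of_ae_mem_closure_range [IsFiniteMeasure μ] (hH : H ≤ mΩ)
    (h0 : ∀ᵐ ω ∂μ, 0 ∈ K ω) {c : ℕ → Ω → E} (hc : ∀ n, StronglyMeasurable[H] (c n))
    (hcK : ∀ n, ∃ ζ : Ω → E, Integrable ζ μ ∧ (∀ᵐ ω ∂μ, ζ ω ∈ K ω) ∧ μ[ζ | H] =ᵐ[μ] c n)
    {f : Lp E 1 μ} (hf : AEStronglyMeasurable[H] f μ)
    (hmem : ∀ᵐ ω ∂μ, f ω ∈ closure (Set.range fun n => c n ω)) :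
    f ∈ closure {g : Lp E 1 μ | ∃ ξ ∈ integrableSelections mΩ μ K, g =ᵐ[μ] μ[ξ | H]} := by
  rw [Metric.mem_closure_iff]
  intro ε hε
  set m := μ.real Set.univ with hm
  have hm0 : 0 ≤ m := measureReal_nonneg
  -- Half of `ε` pays for the uniform error `δ * m`, the other half for the tail of `f'`; `m + 1`
  -- avoids division by zero.
  let δ := ε / (2 * (m + 1))
  have hδ : 0 < δ := by positivity
  have hδm : δ * m < ε / 2 := by
    have : ε / 2 = δ * (m + 1) := by simp only [δ]; field_simp
    rw [this]
    gcongr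
    linarith
  obtain ⟨f', hf', hff'⟩ := hf
  have hf'int : Integrable f' μ := (L1.integrable_coeFn f).congr hff'
  let D : ℕ → Set Ω := fun n => {ω | ‖f' ω - c n ω‖ < δ}
  have hD : ∀ n, MeasurableSet[H] (D n) := fun n =>
    (hf'.sub (hc n)).norm.measurable measurableSet_Iio
  choose ζ hζ hζK hζc using hcK
  -- Glue the generators that are `δ`-close to `f'` one by one; where none of the first `n` is
  -- close, the conditional expectation stays zero.
  have step : ∀ n, ∃ ξ : Ω → E, Integrable ξ μ ∧ (∀ᵐ ω ∂μ, ξ ω ∈ K ω) ∧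
      ∀ᵐ ω ∂μ, ((∃ k < n, ω ∈ D k) → ‖f' ω - (μ[ξ | H]) ω‖ < δ) ∧
        ((∀ k < n, ω ∉ D k) → (μ[ξ | H]) ω = 0) := by
    intro n
    induction n with
    | zero => exact ⟨0, integrable_zero _ _ _, h0, .of_forall fun ω => by simp [condExp_zero]⟩
    | succ n ih =>
      obtain ⟨ξ, hξ, hξK, hξD⟩ := ih
      obtain ⟨η, hη, hηK, hηD⟩ := exists_condExp_piecewise hH (hD n) (hζ n) hξ (hζK n) hξK
      refine ⟨η, hη, hηK, ?_⟩
      filter_upwards [hξD, hηD, hζc n] with ω h1 h2 h3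
      by_cases h : ω ∈ D n
      · refine ⟨fun _ => ?_, fun h4 => absurd h (h4 n n.lt_succ_self)⟩
        rw [h2.1 h, h3]
        exact h
      · rw [h2.2 h]
        refine ⟨fun ⟨k, hk, hkD⟩ => h1.1 ⟨k, ?_, hkD⟩, fun h4 => h1.2 fun k hk =>
          h4 k (hk.trans n.lt_succ_self)⟩
        refine lt_of_le_of_ne (Nat.lt_succ_iff.1 hk) ?_
        rintro rfl
        exact h hkD
  let R : ℕ → Set Ω := fun n => ⋂ k < n, (D k)ᶜ
  have hR : ∀ n, MeasurableSet[mΩ] (R n) := fun n =>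
    .iInter fun k => .iInter fun _ => (hH _ (hD k)).compl
  have hRanti : Antitone R := fun i j hij =>
    Set.biInter_mono (fun k (hk : k < i) => hk.trans_le hij) fun _ _ => le_rfl
  have hRnull : μ (⋂ n, R n) = 0 := by
    rw [measure_eq_zero_iff_ae_notMem]
    filter_upwards [hmem, hff'] with ω h1 h2 h3
    rw [h2, Metric.mem_closure_iff] at h1
    obtain ⟨_, ⟨n, rfl⟩, hn⟩ := h1 δ hδ
    rw [dist_eq_norm] at hn
    exact Set.mem_iInter₂.1 (Set.mem_iInter.1 h3 (n + 1)) n n.lt_succ_self hn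
  have hlim := tendsto_setIntegral_of_antitone (μ := μ) (f := fun ω => ‖f' ω‖) hR hRanti
    ⟨0, hf'int.norm.integrableOn⟩
  rw [setIntegral_measure_zero _ hRnull] at hlim
  obtain ⟨n, hn⟩ := (hlim.eventually_lt_const (show (0 : ℝ) < ε / 2 by positivity)).exists
  obtain ⟨ξ, hξ, hξK, hξD⟩ := step n
  have hgint : Integrable (μ[ξ | H]) μ := integrable_condExp
  refine ⟨hgint.toL1 _, ⟨hξ.toL1 ξ, ⟨Lp.aestronglyMeasurable _, ?_⟩, ?_⟩, ?_⟩
  · filter_upwards [hξ.coeFn_toL1, hξK] with ω h1 h2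
    rwa [h1]
  · exact hgint.coeFn_toL1.trans (condExp_congr_ae hξ.coeFn_toL1.symm)
  · rw [L1.dist_eq_integral_dist]
    have hle : (fun ω => dist (f ω) (hgint.toL1 _ ω)) ≤ᵐ[μ]
        fun ω => δ + (R n).indicator (fun ω => ‖f' ω‖) ω := by
      filter_upwards [hff', hgint.coeFn_toL1, hξD] with ω h1 h2 h3
      rw [h1, h2, dist_eq_norm]
      by_cases h : ω ∈ R n
      · rw [h3.2 (Set.mem_iInter₂.1 h), Set.indicator_of_mem h, sub_zero]
        linarith
      · rw [Set.indicator_of_notMem h, add_zero]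
        simp only [R, Set.mem_iInter, Set.mem_compl_iff, not_forall, not_not] at h
        obtain ⟨k, hk, hkD⟩ := h
        exact (h3.1 ⟨k, hk, hkD⟩).le
    have hint2 : Integrable ((R n).indicator fun ω => ‖f' ω‖) μ := hf'int.norm.indicator (hR n)
    calc ∫ ω, dist (f ω) (hgint.toL1 _ ω) ∂μ
        ≤ ∫ ω, (δ + (R n).indicator (fun ω => ‖f' ω‖) ω) ∂μ :=
          integral_mono_of_nonneg (.of_forall fun _ => dist_nonneg)
            ((integrable_const δ).add hint2) hle
      _ = δ * m + ∫ ω in R n, ‖f' ω‖ ∂μ := by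
          rw [integral_add (integrable_const δ) hint2, integral_indicator (hR n), integral_const,
            smul_eq_mul, mul_comm]
      _ < ε := by linarith

variable [SeparableSpace E]

/-- A random closed convex cone has a conditional convex hull, which is also its conditional
expectation and a cone. -/
theorem exists_isCondHull_isCondExpSet [IsFiniteMeasure μ] (hH : H ≤ mΩ) (hK : IsRandomSet mΩ K)
    (hcone : ∀ᵐ ω ∂μ, IsClosedConvexCone (K ω)) :
    ∃ M, IsCondHull H μ K M ∧ IsCondExpSet H μ K M ∧ ∀ ω, IsClosedConvexCone (M ω) := by
  borelize E
  have := UniformSpace.secondCountable_of_separable E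
  obtain ⟨c, hc, hcK, hM, hKM⟩ := exists_condExp_selections hH hK hcone
  have h0 : ∀ᵐ ω ∂μ, 0 ∈ K ω := hcone.mono fun ω h => h.zero_mem
  let M : Ω → Set E := fun ω => closure (Set.range fun n => c n ω)
  have hMm : IsRandomSet H M := isRandomSet_closure_range (H := H) hc
  have hMcl : ∀ᵐ ω ∂μ, IsClosed (M ω) := .of_forall fun _ => isClosed_closure
  have hMco : ∀ᵐ ω ∂μ, Convex ℝ (M ω) := .of_forall fun ω => (hM ω).convex
  refine ⟨M, ⟨hMm, hMcl, hMco, hKM, fun Z hZ hcl hco hKZ => ?_⟩, ⟨⟨0, ?_, ?_⟩, hMm, hMcl, ?_⟩, hM⟩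
  · have hcZ : ∀ᵐ ω ∂μ, ∀ n, c n ω ∈ Z ω := by
      refine ae_all_iff.2 fun n => ?_
      obtain ⟨ζ, hζ, hζK, hζc⟩ := hcK n
      have h1 : ∀ᵐ ω ∂μ, ζ ω ∈ Z ω := by
        filter_upwards [hKZ, hζK] with ω h2 h3
        exact h2 h3
      filter_upwards [hZ.condExp_mem hH hcl hco hζ h1, hζc] with ω h2 h3
      rwa [← h3]
    filter_upwards [hcZ, hcl] with ω h1 h2
    exact closure_minimal (Set.range_subset_iff.2 h1) h2
  · exact Lp.aestronglyMeasurable _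
  · filter_upwards [h0, Lp.coeFn_zero E 1 μ] with ω h1 h2
    rwa [h2]
  · refine Set.Subset.antisymm (fun f hf => ?_)
      (closure_minimal ?_ (isClosed_integrableSelections hH hMcl))
    · exact mem_closure_condExp_of_ae_mem_closure_range hH h0
        (fun n => (hc n).stronglyMeasurable) hcK hf.1 hf.2
    · rintro g ⟨ξ, hξ, hg⟩
      refine ⟨(stronglyMeasurable_condExp.aestronglyMeasurable).congr hg.symm, ?_⟩
      have h1 : ∀ᵐ ω ∂μ, ξ ω ∈ M ω := by
        filter_upwards [hKM, hξ.2] with ω h2 h3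
        exact h2 h3
      filter_upwards [hg, hMm.condExp_mem hH hMcl hMco (L1.integrable_coeFn ξ) h1] with ω h2 h3
      rwa [h2]

/-- The conditional expectation of a random set containing the origin is unique. -/
theorem IsCondExpSet.ae_eq [IsFiniteMeasure μ] (hH : H ≤ mΩ) (h0 : ∀ᵐ ω ∂μ, 0 ∈ K ω)
    {Y Y' : Ω → Set E} (hY : IsCondExpSet H μ K Y) (hY' : IsCondExpSet H μ K Y') :
    ∀ᵐ ω ∂μ, Y ω = Y' ω := by
  -- The zero selection of `K` puts the origin in every version, so that versions are determined by
  -- their integrable selections.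
  have key : ∀ {Z : Ω → Set E}, IsCondExpSet H μ K Z → ∀ᵐ ω ∂μ, 0 ∈ Z ω := by
    intro Z hZ
    have h1 : (0 : Lp E 1 μ) ∈ integrableSelections H μ Z := by
      rw [hZ.selections_eq]
      refine subset_closure ⟨0, ⟨Lp.aestronglyMeasurable _, ?_⟩, ?_⟩
      · filter_upwards [h0, Lp.coeFn_zero E 1 μ] with ω h1 h2
        rwa [h2]
      · refine (Lp.coeFn_zero E 1 μ).trans ?_
        rw [← condExp_zero (m := H) (μ := μ) (E := E)]
        exact condExp_congr_ae (Lp.coeFn_zero E 1 μ).symm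
    filter_upwards [h1.2, Lp.coeFn_zero E 1 μ] with ω h2 h3
    rwa [h3] at h2
  have hsel := hY.selections_eq.trans hY'.selections_eq.symm
  filter_upwards [ae_subset_of_integrableSelections_subset hH hY.measurable hY'.measurable (key hY)
    hsel.le, ae_subset_of_integrableSelections_subset hH hY'.measurable hY.measurable (key hY')
    hsel.ge] with ω h1 h2
  exact h1.antisymm h2

end Expectation

/-! ### The main theorem -/

theorem proposition7p1 {Ω E : Type*} (H : MeasurableSpace Ω) [mΩ : MeasurableSpace Ω]
    (μ : Measure Ω) [IsProbabilityMeasure μ] [μ.IsComplete] (hH : H ≤ mΩ)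
    [NormedAddCommGroup E] [NormedSpace ℝ E] [CompleteSpace E] [SeparableSpace E]
    (K : Ω → Set E) (hK : IsRandomSet mΩ K) (hcone : ∀ᵐ ω ∂μ, IsClosedConvexCone (K ω)) :
    -- all the objects in the claim exist
    (∃ m, IsCondCore H μ K m) ∧ (∃ M, IsCondHull H μ K M) ∧
    (∃ N, IsCondHull H μ (fun ω => posDual (K ω)) N) ∧ (∃ Y, IsCondExpSet H μ K Y) ∧
    -- the claim, for all versions of these objects
    (∀ m, IsCondCore H μ K m → ∀ᵐ ω ∂μ, IsClosedConvexCone (m ω)) ∧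
    (∀ M, IsCondHull H μ K M → ∀ᵐ ω ∂μ, IsClosedConvexCone (M ω)) ∧
    (∀ m N, IsCondCore H μ K m → IsCondHull H μ (fun ω => posDual (K ω)) N →
      ∀ᵐ ω ∂μ, m ω = posPredual (N ω)) ∧
    (∀ M Y, IsCondHull H μ K M → IsCondExpSet H μ K Y → ∀ᵐ ω ∂μ, Y ω = M ω) := by
  obtain ⟨m, hm⟩ := exists_isCondCore hH hK hcone
  obtain ⟨N, hN, hNm⟩ := hm.exists_isCondHull_posDual hH hcone
  obtain ⟨M, hM, hMY, hMcone⟩ := exists_isCondHull_isCondExpSet hH hK hcone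
  refine ⟨⟨m, hm⟩, ⟨M, hM⟩, ⟨N, hN⟩, ⟨M, hMY⟩, fun m' hm' => hm'.isClosedConvexCone hH hcone,
    fun M' hM' => ?_, fun m' N' hm' hN' => ?_, fun M' Y hM' hY => ?_⟩
  · filter_upwards [hM'.ae_eq hM] with ω h
    rw [h]
    exact hMcone ω
  · filter_upwards [hm'.ae_eq hm, hN'.ae_eq hN, hNm, hm.isClosedConvexCone hH hcone]
      with ω h1 h2 h3 h4
    rw [h1, h2, h3, h4.posPredual_posDual]
  · filter_upwards [hY.ae_eq hH (hcone.mono fun ω h => h.zero_mem) hMY, hM'.ae_eq hM] with ω h1 h2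
    rw [h1, h2]
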